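/- **Setting.** Let $X\in\mathbb{R}^p$ and $Y\in\mathbb{R}^r$ be mean-zero random vectors that follow the multivariate linear model $Y=\alpha+\beta X+\varepsilon$ with $\varepsilon$ independent of $X$, and that are jointly sub-Gaussian with parameter $\sigma>0$: for every unit vector $w\in\mathbb{R}^{p+r}$ and every $t\ge 0$, $P(|w^{\mathsf T}(X^{\mathsf T},Y^{\mathsf T})^{\mathsf T}|\ge t)\le 2e^{-t^2/\sigma^2}$. Put $M=\Sigma_Y=\mathrm{cov}(Y)$, $\Sigma_{YX}=\mathrm{cov}(Y,X)=\Sigma_{XY}^{\mathsf T}$, $U=\Sigma_{YX}\Sigma_{XY}$ and $\nu=\|U\|_{op}$. The response envelope $\mathcal{E}=\mathcal{E}_{\Sigma_Y}(\Sigma_{YX})\subseteq\mathbb{R}^r$ is the intersection of all subspaces $\mathcal{R}$ that contain the column space of $\Sigma_{YX}$ and reduce $M$, i.e. $M=P_{\mathcal R}MP_{\mathcal R}+(I-P_{\mathcal R})M(I-P_{\mathcal R})$, where $P_{\mathcal R}$ is the orthogonal projection onto $\mathcal{R}$. Let $\lambda_1\ge\cdots\ge\lambda_r$ be the eigenvalues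 of $M$ with orthonormal eigenvectors $v_1,\dots,v_r$, put $\lambda_{r+1}=0$, and let $1\le d\le r$. Assume that $\Delta=\min_{1\le j\le d}(\lambda_j-\lambda_{j+1})>0$, that $\mathcal{E}\subseteq\mathrm{span}(v_1,\dots,v_d)$ and that $u=\dim\mathcal{E}\ge1$. Let $\phi_j=v_j^{\mathsf T}Uv_j$ for $1\le j\le d$, with descending order $\phi_{(1)}\ge\cdots\ge\phi_{(d)}$ and $\phi_{(d+1)}=0$; let $\Delta_U=\phi_{(u)}-\phi_{(u+1)}$ and $\tau_0=\max_{1\le k\le d}\|v_k\|_1$. **Estimator.** Let $(X_i,Y_i)$, $i=1,\dots,n$, be i.i.d. copies of $(X,Y)$, let $\widehat\Sigma_{YX}=n^{-1}\sum_i Y_iX_i^{\mathsf T}=\widehat\Sigma_{XY}^{\mathsf T}$ and $\widehat U=\widehat\Sigma_{YX}\widehat\Sigma_{XY}$, and let $\mathbf{Y}^1\in\mathbb{R}^{n\times r}$ be the matrix with rows $Y_i^{\mathsf T}$. For $k=1,\dots,d$ let $(\widehat u_k,\widehat v_k)$ maximize $a^{\mathsf T}\mathbf{Y}^k b$ over $a\in\mathbb{R}^n$,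 $b\in\mathbb{R}^r$ subject to $\|b\|_1\le\tau$, $\|b\|_2^2\le1$, $\|a\|_2^2\le1$, and put $\mathbf{Y}^{k+1}=\mathbf{Y}^k-(\widehat u_k^{\mathsf T}\mathbf{Y}^k\widehat v_k)\,\widehat u_k\widehat v_k^{\mathsf T}$. The sparse NIECE estimator $\widehat{\mathcal E}$ is the span of those $u$ of the vectors $\widehat v_1,\dots,\widehat v_d$ with the largest scores $\widehat v_k^{\mathsf T}\widehat U\widehat v_k$ (maximizers and ties chosen arbitrarily). **Theorem.** For all $d$, $\sigma>0$, $\Delta>0$ and $c_0>0$ there are constants $C,c>0$, which depend on $d,\sigma,\Delta,c_0$ only (so not on $n$, $r$, $p$, $\epsilon$, $\tau$ or $u$), such that in the above setting, if $0<\epsilon\le 1/p$, $\tau>\tau_0$ and $$\Delta_U>\sqrt{8c_0\nu^2\tau^2\epsilon}+(2c_0\nu+1)\tau^2\epsilon,$$ then $$\|P_{\widehat{\mathcal E}}-P_{\mathcal E}\|_F^2\le C\epsilon\tau^2$$ with probability greater than $1-Cr^2e^{-cn\epsilon^2}-Cpr\,e^{-cn\epsilon^2}$. -/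

import Mathlib

open MeasureTheory ProbabilityTheory
open scoped Matrix

namespace NIECE

noncomputable section

/-! Linear algebra: norms, projections, reducing subspaces and envelopes. -/

/-- The Frobenius norm of a real matrix. -/
def frobNorm {m k : ℕ} (A : Matrix (Fin m) (Fin k) ℝ) : ℝ :=
  Real.sqrt (∑ i, ∑ j, (A i j) ^ 2)

/-- The operator norm of a real square matrix, acting on Euclidean space. -/
def opNorm {r : ℕ} (A : Matrix (Fin r) (Fin r) ℝ) : ℝ :=
  ‖Matrix.toEuclideanCLM (𝕜 := ℝ) (n := Fin r) A‖

/-- The `ℓ₁` norm of a vector. -/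
def l1Norm {r : ℕ} (x : Fin r → ℝ) : ℝ := ∑ i, |x i|

/-- The matrix of the orthogonal projection onto a subspace `S` of `ℝʳ`. -/
def projMatrix {r : ℕ} (S : Submodule ℝ (EuclideanSpace ℝ (Fin r))) :
    Matrix (Fin r) (Fin r) ℝ :=
  Matrix.of fun i j => (S.starProjection (EuclideanSpace.single j (1 : ℝ))) i

/-- The column space of an `r × k` matrix, as a subspace of `ℝʳ`. -/
def colSpan {r k : ℕ} (A : Matrix (Fin r) (Fin k) ℝ) :
    Submodule ℝ (EuclideanSpace ℝ (Fin r)) :=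
  Submodule.span ℝ (Set.range fun j : Fin k => WithLp.toLp 2 (fun i : Fin r => A i j))

/-- `R` is a reducing subspace of `M`, i.e. `M = P M P + Q M Q` where `P` is the projection
onto `R` and `Q = I - P`. -/
def IsReducing {r : ℕ} (M : Matrix (Fin r) (Fin r) ℝ)
    (R : Submodule ℝ (EuclideanSpace ℝ (Fin r))) : Prop :=
  M = projMatrix R * M * projMatrix R + (1 - projMatrix R) * M * (1 - projMatrix R)

/-- The `M`-envelope of `span A`: the intersection of all reducing subspaces of `M` that
contain the column space of `A`. -/
def envelope {r k : ℕ} (M : Matrix (Fin r) (Fin r) ℝ) (A : Matrix (Fin r) (Fin k) ℝ) :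
    Submodule ℝ (EuclideanSpace ℝ (Fin r)) :=
  sInf {R | IsReducing M R ∧ colSpan A ≤ R}

/-! Spectral quantities of the population matrices. -/

/-- `(lam, v)` is a full ordered eigendecomposition of `M`: the `v j` form an orthonormal basis,
`M v j = lam j • v j`, and `lam 0 ≥ lam 1 ≥ ⋯`. -/
structure IsOrderedEigenbasis {r : ℕ} (M : Matrix (Fin r) (Fin r) ℝ) (lam : Fin r → ℝ)
    (v : OrthonormalBasis (Fin r) ℝ (EuclideanSpace ℝ (Fin r))) : Prop where
  eigen : ∀ j, M *ᵥ (v j).ofLp = lam j • (v j).ofLp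
  antitone : Antitone lam

/-- The eigenvalue sequence (indexed from `0`), extended by `0` beyond the dimension. -/
def eigSeq {r : ℕ} (lam : Fin r → ℝ) (j : ℕ) : ℝ := if h : j < r then lam ⟨j, h⟩ else 0

/-- The minimal eigen-gap `min_{1 ≤ j ≤ d} (λ_j - λ_{j+1})`. -/
def minEigenGap {r : ℕ} (lam : Fin r → ℝ) (d : ℕ) : ℝ :=
  ⨅ j : Fin d, (eigSeq lam j - eigSeq lam (j + 1))

/-- The first `d` of the vectors `v j`. -/
def leading {r d : ℕ} (hd : d ≤ r)
    (v : OrthonormalBasis (Fin r) ℝ (EuclideanSpace ℝ (Fin r))) (k : Fin d) :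
    EuclideanSpace ℝ (Fin r) := v (Fin.castLE hd k)

/-- `max_k ‖v_k‖₁` over a finite family of vectors. -/
def maxL1 {r d : ℕ} (v : Fin d → EuclideanSpace ℝ (Fin r)) : ℝ :=
  ⨆ k : Fin d, l1Norm (v k).ofLp

/-- The envelope score `xᵀ U x` of a vector `x`. -/
def score {r : ℕ} (U : Matrix (Fin r) (Fin r) ℝ) (x : Fin r → ℝ) : ℝ := x ⬝ᵥ (U *ᵥ x)

/-- The scores `φ` in descending order: `ordered φ j` is the `(j+1)`-th largest of the `d` values,
and `0` for `j ≥ d`. -/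
def ordered {d : ℕ} (φ : Fin d → ℝ) (j : ℕ) : ℝ :=
  if h : j < d then φ (Tuple.sort (fun k => -φ k) ⟨j, h⟩) else 0

/-- The envelope score gap `φ_(u) - φ_(u+1)`. -/
def scoreGap {d : ℕ} (φ : Fin d → ℝ) (u : ℕ) : ℝ := ordered φ (u - 1) - ordered φ u

/-! The sparse NIECE estimator. -/

/-- The feasible set of the rank-one penalized matrix decomposition: pairs `(a, b)` with
`‖b‖₁ ≤ τ`, `‖b‖₂² ≤ 1` and `‖a‖₂² ≤ 1`. -/
def pmdFeasible (n r : ℕ) (τ : ℝ) : Set ((Fin n → ℝ) × (Fin r → ℝ)) :=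
  {q | l1Norm q.2 ≤ τ ∧ ∑ i, (q.2 i) ^ 2 ≤ 1 ∧ ∑ i, (q.1 i) ^ 2 ≤ 1}

/-- The successively deflated data matrices: `X¹ = X` and
`Xᵏ⁺¹ = Xᵏ - σ_k a_k b_kᵀ` with `σ_k = a_kᵀ Xᵏ b_k` (indices are shifted to start at `0`). -/
def deflated {n r : ℕ} (X : Matrix (Fin n) (Fin r) ℝ) (a : ℕ → Fin n → ℝ)
    (b : ℕ → Fin r → ℝ) : ℕ → Matrix (Fin n) (Fin r) ℝ
  | 0 => X
  | k + 1 => deflated X a b k -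
      (a k ⬝ᵥ (deflated X a b k *ᵥ b k)) • Matrix.vecMulVec (a k) (b k)

/-- `(a_k, b_k)`, `k < d`, is an output of the `d`-step penalized matrix decomposition of `X`:
each pair maximizes `aᵀ Xᵏ b` over the feasible set. -/
def IsPMD {n r : ℕ} (X : Matrix (Fin n) (Fin r) ℝ) (τ : ℝ) (d : ℕ) (a : ℕ → Fin n → ℝ)
    (b : ℕ → Fin r → ℝ) : Prop :=
  ∀ k < d, (a k, b k) ∈ pmdFeasible n r τ ∧
    IsMaxOn (fun q : (Fin n → ℝ) × (Fin r → ℝ) => q.1 ⬝ᵥ (deflated X a b k *ᵥ q.2))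
      (pmdFeasible n r τ) (a k, b k)

/-- The sample (cross-)covariance matrix `n⁻¹ ∑ A_i B_iᵀ` of mean-zero data, with the
observations in the rows of `A` and `B`. -/
def sampleCov {n k l : ℕ} (A : Matrix (Fin n) (Fin k) ℝ) (B : Matrix (Fin n) (Fin l) ℝ) :
    Matrix (Fin k) (Fin l) ℝ := (n : ℝ)⁻¹ • (Aᵀ * B)

/-- `E` is an output of sparse NIECE for the response envelope, computed from the predictor
data `X` and the response data `Y`: sparse directions from the penalized matrix decomposition of
`Y`, ordered by their envelope scores with respect to `Σ̂_YX Σ̂_XY`; `E` is the span of the first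
`u` directions. Maximizers and ties among the scores may be chosen arbitrarily. -/
def IsSparseNIECE {n p r : ℕ} (X : Matrix (Fin n) (Fin p) ℝ) (Y : Matrix (Fin n) (Fin r) ℝ)
    (τ : ℝ) (d u : ℕ) (E : Submodule ℝ (EuclideanSpace ℝ (Fin r))) : Prop :=
  ∃ (a : ℕ → Fin n → ℝ) (b : ℕ → Fin r → ℝ) (π : Equiv.Perm (Fin d)),
    IsPMD Y τ d a b ∧
    Antitone (fun k : Fin d => score (sampleCov Y X * sampleCov X Y) (b (π k))) ∧
    E = Submodule.span ℝ {x | ∃ k : Fin d, (k : ℕ) < u ∧ x = WithLp.toLp 2 (b (π k))}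

/-! The population model. -/

/-- The population (cross-)covariance matrix of two random vectors. -/
def covMatrix {Ω : Type*} [MeasurableSpace Ω] {k l : ℕ} (A : Ω → Fin k → ℝ)
    (B : Ω → Fin l → ℝ) (P : Measure Ω) : Matrix (Fin k) (Fin l) ℝ :=
  Matrix.of fun i j => cov[fun ω => A ω i, fun ω => B ω j; P]

/-- The joint sub-Gaussian condition on `(Xᵀ, Yᵀ)ᵀ` with parameter `σ`: every unit linear
combination `Z` satisfies `P(|Z| ≥ t) ≤ 2 exp(-t²/σ²)` for all `t ≥ 0`. -/
def JointSubGaussian {Ω : Type*} [MeasurableSpace Ω] {p r : ℕ} (X : Ω → Fin p → ℝ)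
    (Y : Ω → Fin r → ℝ) (P : Measure Ω) (σ : ℝ) : Prop :=
  ∀ (w₁ : Fin p → ℝ) (w₂ : Fin r → ℝ), ∑ i, (w₁ i) ^ 2 + ∑ i, (w₂ i) ^ 2 = 1 →
    ∀ t : ℝ, 0 ≤ t →
      P.real {ω | t ≤ |w₁ ⬝ᵥ X ω + w₂ ⬝ᵥ Y ω|} ≤ 2 * Real.exp (-t ^ 2 / σ ^ 2)

/-- The multivariate linear model `Y = α + β X + e`, with error `e` independent of `X`, for
mean-zero `X` and `Y`. -/
structure IsLinearModel {Ω : Type*} [MeasurableSpace Ω] {p r : ℕ} (X : Ω → Fin p → ℝ)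
    (Y e : Ω → Fin r → ℝ) (α : Fin r → ℝ) (β : Matrix (Fin r) (Fin p) ℝ)
    (P : Measure Ω) : Prop where
  measurable_X : Measurable X
  measurable_e : Measurable e
  model : ∀ ω, Y ω = α + β *ᵥ X ω + e ω
  indep : IndepFun e X P
  mean_X : ∀ i, ∫ ω, X ω i ∂P = 0
  mean_Y : ∀ i, ∫ ω, Y ω i ∂P = 0

end

end NIECE

open NIECE

/-! ### Deflation along directions close to an orthonormal basis. -/

section Perturbation

variable {V : Type*} [NormedAddCommGroup V] [InnerProductSpace ℝ V]

/-! Everything is deterministic once the entries of the sample covariances are within `η = δ * ε` of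
the population ones, where `δ` is a small constant.

At a maximizing pair the left factor satisfies `σ_k a_k = Yᵏ b_k`, so deflating the data amounts to
multiplying `Y` on the right by `I - b_k b_kᵀ` (`deflated_mulVec`). Hence `b_k` maximizes the sample
quadratic form at the deflated vector. Deflated vectors have `ℓ₁` norm at most `d * τ`, so replacing
the sample covariance by `M` costs at most `d² τ² η`. If the earlier directions are within `h` of
signed eigenvectors, the form of `M` at a deflated `b` is at most `λ_k - (D/2)(1 - ⟨v_k, b⟩²) +
O(h²)` (`quad_deflate_le`), and at the feasible competitor `v_k` it is at least `λ_k - O(h²)`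
(`le_quad_deflate`). The errors are quadratic in `h`; linear ones would destroy the rate. Comparing
the two bounds and inducting on `k` gives `‖b_k ∓ v_k‖² ≤ G τ² η`
(`NIECE.IsPMD.exists_norm_sub_sq_le`).

The gaps make the leading eigenvalues simple, so the envelope is spanned by the `v_k`, `k < d`, with
`Σ_XY v_k ≠ 0` (`envelope_eq_span`). Population scores are squared norms `‖Σ_XY v_k‖²`: zero off the
envelope, at least the score gap on it. The norms are estimated within some `e` with `4 e² ≤ (2 c₀ ν
+ 1) τ² ε`, so the `u` largest sample scores pick the right indices, and closeness of the directions
passes to the projections (`frobNorm_projMatrix_sub_span_le`).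

Products of sub-Gaussian variables have exponential moments; a Chernoff bound
(`measureReal_abs_mean_sub_le`) and a union bound over the `r² + pr` entries make the accuracy event
likely. -/

/-- Successive rank-one deflation of `b` along `x (k - 1), …, x 0`. -/
def deflate (x : ℕ → V) : ℕ → V → V
  | 0, b => b
  | k + 1, b => deflate x k (b - inner ℝ (x k) b • x k)

theorem norm_sub_inner_smul_le (x b : V) (hx : ‖x‖ ≤ 1) : ‖b - inner ℝ x b • x‖ ≤ ‖b‖ := by
  refine le_of_sq_le_sq ?_ (norm_nonneg b)
  rw [norm_sub_sq_real, inner_smul_right, norm_smul, mul_pow, Real.norm_eq_abs, sq_abs,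
    real_inner_comm]
  nlinarith [mul_le_mul_of_nonneg_left (pow_le_one₀ (n := 2) (norm_nonneg x) hx)
    (sq_nonneg (inner ℝ b x)), sq_nonneg (inner ℝ b x)]

theorem abs_inner_le_of_le {x y : V} {a b : ℝ} (hx : ‖x‖ ≤ a) (hy : ‖y‖ ≤ b) :
    |inner ℝ x y| ≤ a * b :=
  (abs_real_inner_le_norm x y).trans
    (mul_le_mul hx hy (norm_nonneg _) ((norm_nonneg _).trans hx))

/-- Coefficients of a deflated vector when the deflation directions `x j` are within `h` of an
orthonormal family `w j`. -/
theorem exists_deflate_coeff (x w : ℕ → V) {h : ℝ} (h0 : 0 ≤ h) (k : ℕ)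
    (hx : ∀ j < k, ‖x j‖ ≤ 1) (hw : ∀ j < k, ‖w j‖ ≤ 1)
    (hww : ∀ i < k, ∀ j < k, i ≠ j → inner ℝ (w i) (w j) = 0)
    (hxw : ∀ j < k, ‖x j - w j‖ ≤ h) (b : V) (hb : ‖b‖ ≤ 1) :
    ∃ c : ℕ → ℝ, deflate x k b = b - ∑ j ∈ Finset.range k, c j • x j ∧
      ∀ j < k, |c j| ≤ 1 ∧ |c j - inner ℝ (w j) b| ≤ k * h := by
  induction k generalizing b with
  | zero => exact ⟨0, by simp [deflate], by simp⟩
  | succ k ih =>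
    have hxk := hx k (Nat.lt_succ_self k)
    obtain ⟨c, hc, hc'⟩ := ih (fun j hj => hx j (by omega)) (fun j hj => hw j (by omega))
      (fun i hi j hj => hww i (by omega) j (by omega)) (fun j hj => hxw j (by omega))
      (b - inner ℝ (x k) b • x k) ((norm_sub_inner_smul_le _ _ hxk).trans hb)
    have hck : |inner ℝ (x k) b| ≤ 1 := by simpa using abs_inner_le_of_le hxk hb
    refine ⟨fun j => if j = k then inner ℝ (x k) b else c j, ?_, ?_⟩
    · rw [deflate, hc, Finset.sum_range_succ, sub_sub, add_comm]
      simp only [if_true]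
      congr 2
      exact Finset.sum_congr rfl fun j hj => by rw [if_neg (Finset.mem_range.1 hj).ne]
    · intro j hj
      rcases eq_or_ne j k with rfl | hjk
      · simp only [if_true]
        refine ⟨hck, ?_⟩
        rw [← inner_sub_left]
        have := abs_inner_le_of_le (hxw j hj) hb
        push_cast
        nlinarith [(Nat.cast_nonneg j : (0 : ℝ) ≤ j)]
      · have hj' : j < k := by omega
        simp only [if_neg hjk]
        refine ⟨(hc' j hj').1, ?_⟩
        have h1 := (hc' j hj').2
        -- Since `w j ⊥ w k`, only `x k - w k` contributes, so each deflation moves the remaining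
        -- coefficients by at most `h`.
        have h2 : |inner ℝ (w j) (x k)| ≤ h := by
          have : inner ℝ (w j) (x k) = inner ℝ (w j) (x k - w k) := by
            rw [inner_sub_right, hww j (by omega) k (by omega) hjk, sub_zero]
          rw [this]
          simpa using abs_inner_le_of_le (hw j (by omega)) (hxw k (by omega))
        rw [inner_sub_right, inner_smul_right] at h1
        have h3 : |inner ℝ (x k) b * inner ℝ (w j) (x k)| ≤ 1 * h := by
          rw [abs_mul]; exact mul_le_mul hck h2 (abs_nonneg _) zero_le_one
        push_cast
        rw [abs_le] at *
        constructor <;> linarith [h1.1, h1.2, h3.1, h3.2]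

/-- The remainder is `g = ∑ c j • (x j - w j)`. Its second bound is the important one: `g` is of
order `h²` unless `b` has components along the earlier `w j`, and those components are what
deflation removes. -/
theorem exists_deflate_eq (x w : ℕ → V) {h : ℝ} (h0 : 0 ≤ h) (k : ℕ)
    (hx : ∀ j < k, ‖x j‖ ≤ 1) (hw : ∀ j < k, ‖w j‖ ≤ 1)
    (hww : ∀ i < k, ∀ j < k, i ≠ j → inner ℝ (w i) (w j) = 0)
    (hxw : ∀ j < k, ‖x j - w j‖ ≤ h) (b : V) (hb : ‖b‖ ≤ 1) :
    ∃ (c : ℕ → ℝ) (g : V), deflate x k b = b - ∑ j ∈ Finset.range k, c j • w j - g ∧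
      (∀ j < k, |c j - inner ℝ (w j) b| ≤ k * h) ∧ ‖g‖ ≤ k * h ∧
      ‖g‖ ≤ h * ∑ j ∈ Finset.range k, |inner ℝ (w j) b| + k ^ 2 * h ^ 2 := by
  obtain ⟨c, hc, hc'⟩ := exists_deflate_coeff x w h0 k hx hw hww hxw b hb
  have hg : ‖∑ j ∈ Finset.range k, c j • (x j - w j)‖ ≤ ∑ j ∈ Finset.range k, |c j| * h := by
    refine norm_sum_le_of_le _ fun j hj => ?_
    rw [norm_smul, Real.norm_eq_abs]
    exact mul_le_mul_of_nonneg_left (hxw j (Finset.mem_range.1 hj)) (abs_nonneg _)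
  refine ⟨c, ∑ j ∈ Finset.range k, c j • (x j - w j), ?_, fun j hj => (hc' j hj).2, ?_, ?_⟩
  · rw [hc, sub_sub, ← Finset.sum_add_distrib]
    simp [smul_sub]
  · refine hg.trans ?_
    refine (Finset.sum_le_card_nsmul _ _ h fun j hj => ?_).trans_eq (by simp)
    nlinarith [(hc' j (Finset.mem_range.1 hj)).1]
  · refine hg.trans ?_
    have : ∀ j ∈ Finset.range k, |c j| * h ≤ h * |inner ℝ (w j) b| + k * h ^ 2 := by
      intro j hj
      have h1 := (hc' j (Finset.mem_range.1 hj)).2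
      have h2 := abs_sub_abs_le_abs_sub (c j) (inner ℝ (w j) b)
      nlinarith
    refine (Finset.sum_le_sum this).trans_eq ?_
    rw [Finset.sum_add_distrib, Finset.mul_sum]
    simp; ring

variable {r : ℕ}

theorem exists_deflate_inner (v : OrthonormalBasis (Fin r) ℝ V) (x : ℕ → V) (s : ℕ → ℝ) {h : ℝ}
    (h0 : 0 ≤ h) (k : Fin r) (hx : ∀ j < (k : ℕ), ‖x j‖ ≤ 1) (hs : ∀ j, |s j| = 1)
    (hxw : ∀ j : Fin r, j < k → ‖x j - s j • v j‖ ≤ h) (b : V) (hb : ‖b‖ ≤ 1) :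
    ∃ g : V, (∀ i, k ≤ i → inner ℝ (v i) (deflate x k b) = inner ℝ (v i) b - inner ℝ (v i) g) ∧
      (∀ i, i < k → |inner ℝ (v i) (deflate x k b)| ≤ 2 * k * h) ∧ ‖g‖ ≤ k * h ∧
      ‖g‖ ≤ h * ∑ j ∈ Finset.Iio k, |inner ℝ (v j) b| + k ^ 2 * h ^ 2 := by
  -- Only indices below `k < r` are used, so the value `0` is never met.
  set w : ℕ → V := fun j => if hj : j < r then s j • v ⟨j, hj⟩ else 0 with hwdef
  have hwv : ∀ j : Fin r, w j = s j • v j := fun j => by simp [hwdef]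
  have hlt : ∀ j < (k : ℕ), ∃ i : Fin r, (i : ℕ) = j ∧ i < k := fun j hj =>
    ⟨⟨j, hj.trans k.2⟩, rfl, hj⟩
  obtain ⟨c, g, hz, hc, hg1, hg2⟩ := exists_deflate_eq x w h0 k hx
    (fun j hj => by
      obtain ⟨i, rfl, -⟩ := hlt j hj
      rw [hwv, norm_smul, Real.norm_eq_abs, hs, v.orthonormal.1, one_mul])
    (fun i hi j hj hij => by
      obtain ⟨i, rfl, -⟩ := hlt i hi
      obtain ⟨j, rfl, -⟩ := hlt j hj
      rw [hwv, hwv, inner_smul_left, inner_smul_right, v.orthonormal.2 (fun h => hij (by rw [h]))]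
      simp)
    (fun j hj => by
      obtain ⟨i, rfl, hi⟩ := hlt j hj
      rw [hwv]; exact hxw i hi) b hb
  have hsum : ∀ f : ℕ → V, ∑ j ∈ Finset.range k, f j = ∑ j ∈ Finset.Iio k, f j := fun f => by
    rw [← Nat.Iio_eq_range, ← Fin.map_valEmbedding_Iio, Finset.sum_map]; rfl
  have hsum' : ∀ f : ℕ → ℝ, ∑ j ∈ Finset.range k, f j = ∑ j ∈ Finset.Iio k, f j := fun f => by
    rw [← Nat.Iio_eq_range, ← Fin.map_valEmbedding_Iio, Finset.sum_map]; rfl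
  have hinner : ∀ i, inner ℝ (v i) (∑ j ∈ Finset.range k, c j • w j) =
      if i < k then c i * s i else 0 := fun i => by
    rw [hsum, inner_sum]
    simp only [hwv, inner_smul_right, orthonormal_iff_ite.1 v.orthonormal i]
    simp
  refine ⟨g, fun i hi => ?_, fun i hi => ?_, hg1, hg2.trans_eq ?_⟩
  · rw [hz, inner_sub_right, inner_sub_right, hinner, if_neg (not_lt.2 hi), sub_zero]
  · rw [hz, inner_sub_right, inner_sub_right, hinner, if_pos hi]
    have h1 := hc i hi
    rw [hwv, inner_smul_left, conj_trivial] at h1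
    have hss : s i * s i = 1 := by rw [← abs_mul_abs_self, hs, one_mul]
    have h2 : |inner ℝ (v i) b - c i * s i| ≤ k * h := by
      have : inner ℝ (v i) b - c i * s i = - (s i * (c i - s i * inner ℝ (v i) b)) := by
        linear_combination (- inner ℝ (v i) b) * hss
      rw [this, abs_neg, abs_mul, hs, one_mul]; exact h1
    have h3 := abs_inner_le_of_le (v.orthonormal.1 i).le hg1
    refine (abs_sub _ _).trans ?_
    linarith
  · rw [hsum']
    congr 2
    refine Finset.sum_congr rfl fun j _ => ?_
    rw [hwv, inner_smul_left, conj_trivial, abs_mul, hs, one_mul]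

theorem sum_inner_sq_eq (v : OrthonormalBasis (Fin r) ℝ V) (b : V) :
    ∑ i, inner ℝ (v i) b ^ 2 = ‖b‖ ^ 2 := by
  rw [← v.sum_sq_norm_inner_right b]; simp

/-- Upper bound for a quadratic form at a deflated vector. -/
theorem quad_deflate_le (v : OrthonormalBasis (Fin r) ℝ V) (lam : Fin r → ℝ)
    (hlam : Antitone lam) (lam0 : ∀ i, 0 ≤ lam i) {L : ℝ} (hL : ∀ i, lam i ≤ L)
    (x : ℕ → V) (s : ℕ → ℝ) {h : ℝ} (h0 : 0 ≤ h) (k : Fin r) {D : ℝ}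
    (hD : D ≤ lam k) (hgap : ∀ i, k < i → lam i + D ≤ lam k) (hD0 : 0 ≤ D)
    (hx : ∀ j < (k : ℕ), ‖x j‖ ≤ 1) (hs : ∀ j, |s j| = 1)
    (hxw : ∀ j : Fin r, j < k → ‖x j - s j • v j‖ ≤ h) (b : V) (hb : ‖b‖ ≤ 1) :
    ∑ i, lam i * inner ℝ (v i) (deflate x k b) ^ 2 ≤
      lam k - D / 2 * (1 - inner ℝ (v k) b ^ 2) + L * (4 * k ^ 3 + 2 * k + 3 * k ^ 2) * h ^ 2 := by
  obtain ⟨g, hge, hlt, hg1, hg2⟩ := exists_deflate_inner v x s h0 k hx hs hxw b hb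
  have hL0 : 0 ≤ L := (lam0 k).trans (hL k)
  have hk0 : (0 : ℝ) ≤ k := Nat.cast_nonneg _
  have hfilter : Finset.univ.filter (· < k) = Finset.Iio k := by ext; simp
  have key : ∀ i, lam i * inner ℝ (v i) (deflate x k b) ^ 2 ≤
      (if i < k then 0 else lam i * inner ℝ (v i) b ^ 2) +
      (if i < k then L * (2 * k * h) ^ 2 else 0) +
      2 * lam k * (|inner ℝ (v i) b| * |inner ℝ (v i) g|) + L * inner ℝ (v i) g ^ 2 := by
    intro i
    have p1 : 0 ≤ L * inner ℝ (v i) g ^ 2 := by positivity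
    have p2 : 0 ≤ |inner ℝ (v i) b| * |inner ℝ (v i) g| := by positivity
    have p3 := mul_nonneg (lam0 k) p2
    by_cases hi : i < k
    · rw [if_pos hi, if_pos hi]
      have h1 : inner ℝ (v i) (deflate x k b) ^ 2 ≤ (2 * k * h) ^ 2 :=
        sq_le_sq.2 ((hlt i hi).trans (le_abs_self _))
      have := mul_le_mul (hL i) h1 (sq_nonneg _) hL0
      linarith
    · rw [if_neg hi, if_neg hi, hge i (not_lt.1 hi)]
      have h1 := hlam (not_lt.1 hi)
      have h2 : lam i * inner ℝ (v i) g ^ 2 ≤ L * inner ℝ (v i) g ^ 2 :=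
        mul_le_mul_of_nonneg_right (hL i) (sq_nonneg _)
      have h3 : lam i * (|inner ℝ (v i) b| * |inner ℝ (v i) g|) ≤
        lam k * (|inner ℝ (v i) b| * |inner ℝ (v i) g|) := mul_le_mul_of_nonneg_right h1 p2
      have h4 : - (inner ℝ (v i) b * inner ℝ (v i) g) ≤ |inner ℝ (v i) b| * |inner ℝ (v i) g| := by
        rw [← abs_mul]; exact neg_le_abs _
      have h5 := mul_le_mul_of_nonneg_left h4 (lam0 i)
      nlinarith
  -- Cauchy–Schwarz and Parseval.
  have hcs : ∑ i, |inner ℝ (v i) b| * |inner ℝ (v i) g| ≤ ‖g‖ := by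
    have h1 := Finset.sum_mul_sq_le_sq_mul_sq Finset.univ (fun i => |inner ℝ (v i) b|)
      (fun i => |inner ℝ (v i) g|)
    simp only [sq_abs, sum_inner_sq_eq] at h1
    refine le_of_sq_le_sq (h1.trans ?_) (norm_nonneg g)
    exact mul_le_of_le_one_left (sq_nonneg _) (pow_le_one₀ (norm_nonneg _) hb)
  have hcard : ∑ i, (if i < k then L * (2 * k * h) ^ 2 else 0) = 4 * L * k ^ 3 * h ^ 2 := by
    rw [← Finset.sum_filter, Finset.sum_const, hfilter]
    simp; ring
  -- The cross term is linear in `h`. Young's inequality trades it for `h²` plus half of `lam k * ⟨v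
  -- j, b⟩²`, which is affordable because the coordinates `j < k` have dropped out of the main sum.
  have hcross : 2 * lam k * ‖g‖ ≤ ∑ j ∈ Finset.Iio k, lam k / 2 * inner ℝ (v j) b ^ 2 +
      L * (2 * k + 2 * k ^ 2) * h ^ 2 := by
    have h1 : ∀ j ∈ Finset.Iio k, 2 * lam k * (h * |inner ℝ (v j) b|) ≤
        lam k / 2 * inner ℝ (v j) b ^ 2 + 2 * L * h ^ 2 := fun j _ => by
      have h2 : 2 * (h * |inner ℝ (v j) b|) ≤ inner ℝ (v j) b ^ 2 / 2 + 2 * h ^ 2 := by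
        rw [← sq_abs (inner ℝ (v j) b)]
        nlinarith [sq_nonneg (|inner ℝ (v j) b| - 2 * h)]
      have h3 := mul_le_mul_of_nonneg_left h2 (lam0 k)
      have h4 := mul_le_mul_of_nonneg_right (hL k) (sq_nonneg h)
      nlinarith
    have h2 := Finset.sum_le_sum h1
    rw [← Finset.mul_sum, ← Finset.mul_sum, Finset.sum_add_distrib (f := fun j =>
      lam k / 2 * inner ℝ (v j) b ^ 2), Finset.sum_const] at h2
    simp only [Fin.card_Iio, nsmul_eq_mul] at h2
    have h3 := mul_le_mul_of_nonneg_left hg2 (lam0 k)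
    have h4 : lam k * (k ^ 2 * h ^ 2) ≤ L * (k ^ 2 * h ^ 2) :=
      mul_le_mul_of_nonneg_right (hL k) (by positivity)
    nlinarith
  -- The weights are `lam k / 2` below `k`, `lam k` at `k` and `lam i` above `k`; off `k` all are at
  -- most `lam k - D / 2`, by `hD` and `hgap`.
  have hmain : ∑ i, (if i < k then 0 else lam i * inner ℝ (v i) b ^ 2) +
      ∑ j ∈ Finset.Iio k, lam k / 2 * inner ℝ (v j) b ^ 2 ≤
      lam k - D / 2 * (1 - inner ℝ (v k) b ^ 2) := by
    have h1 : ∑ j ∈ Finset.Iio k, lam k / 2 * inner ℝ (v j) b ^ 2 =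
        ∑ j, if j < k then lam k / 2 * inner ℝ (v j) b ^ 2 else 0 := by
      rw [← Finset.sum_filter, hfilter]
    rw [h1, ← Finset.sum_add_distrib]
    have h2 : ∀ i, ((if i < k then 0 else lam i * inner ℝ (v i) b ^ 2) +
        if i < k then lam k / 2 * inner ℝ (v i) b ^ 2 else 0) ≤
        (lam k - D / 2) * inner ℝ (v i) b ^ 2 + if i = k then D / 2 * inner ℝ (v i) b ^ 2 else 0 := by
      intro i
      have h3 := sq_nonneg (inner ℝ (v i) b)
      rcases lt_trichotomy i k with h4 | h4 | h4
      · rw [if_pos h4, if_pos h4, if_neg h4.ne]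
        nlinarith
      · subst h4
        simp only [lt_irrefl, if_false, if_true]
        linarith
      · rw [if_neg h4.not_gt, if_neg h4.not_gt, if_neg h4.ne']
        have := hgap i h4
        nlinarith
    refine (Finset.sum_le_sum fun i _ => h2 i).trans ?_
    rw [Finset.sum_add_distrib, ← Finset.mul_sum, sum_inner_sq_eq]
    simp only [Finset.sum_ite_eq', Finset.mem_univ, if_true]
    have h5 : (lam k - D / 2) * ‖b‖ ^ 2 ≤ lam k - D / 2 :=
      mul_le_of_le_one_right (by linarith) (pow_le_one₀ (norm_nonneg _) hb)
    linarith
  refine (Finset.sum_le_sum fun i _ => key i).trans ?_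
  rw [Finset.sum_add_distrib, Finset.sum_add_distrib, Finset.sum_add_distrib, hcard,
    ← Finset.mul_sum, ← Finset.mul_sum, sum_inner_sq_eq]
  have h6 : L * ‖g‖ ^ 2 ≤ L * (k * h) ^ 2 :=
    mul_le_mul_of_nonneg_left (pow_le_pow_left₀ (norm_nonneg _) hg1 2) hL0
  have h7 := mul_le_mul_of_nonneg_left hcs (lam0 k)
  linarith

/-- Lower bound for a quadratic form at the deflation of an eigenvector. -/
theorem le_quad_deflate (v : OrthonormalBasis (Fin r) ℝ V) (lam : Fin r → ℝ)
    (lam0 : ∀ i, 0 ≤ lam i) {L : ℝ} (hL : ∀ i, lam i ≤ L)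
    (x : ℕ → V) (s : ℕ → ℝ) {h : ℝ} (h0 : 0 ≤ h) (k : Fin r)
    (hx : ∀ j < (k : ℕ), ‖x j‖ ≤ 1) (hs : ∀ j, |s j| = 1)
    (hxw : ∀ j : Fin r, j < k → ‖x j - s j • v j‖ ≤ h) :
    lam k - 2 * L * k ^ 2 * h ^ 2 ≤ ∑ i, lam i * inner ℝ (v i) (deflate x k (v k)) ^ 2 := by
  obtain ⟨g, hge, -, -, hg⟩ := exists_deflate_inner v x s h0 k hx hs hxw (v k)
    (v.orthonormal.1 k).le
  -- `v k` has no component along earlier directions, so the remainder is of order `h²`; keeping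
  -- only the `k`-th term of the form then suffices.
  have h0 : ∑ j ∈ Finset.Iio k, |inner ℝ (v j) (v k)| = 0 :=
    Finset.sum_eq_zero fun j hj => by
      rw [v.orthonormal.2 (Finset.mem_Iio.1 hj).ne, abs_zero]
  rw [h0, mul_zero, zero_add] at hg
  have h1 := (le_abs_self _).trans (abs_inner_le_of_le (v.orthonormal.1 k).le hg)
  have h2 : lam k * inner ℝ (v k) (deflate x k (v k)) ^ 2 ≤
      ∑ i, lam i * inner ℝ (v i) (deflate x k (v k)) ^ 2 :=
    Finset.single_le_sum (f := fun i => lam i * inner ℝ (v i) (deflate x k (v k)) ^ 2)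
      (fun i _ => mul_nonneg (lam0 i) (sq_nonneg _)) (Finset.mem_univ k)
  refine le_trans ?_ h2
  rw [hge k le_rfl, real_inner_self_eq_norm_sq, v.orthonormal.1 k]
  have h3 : 1 - 2 * (k ^ 2 * h ^ 2) ≤ (1 ^ 2 - inner ℝ (v k) g) ^ 2 := by
    nlinarith [sq_nonneg (inner ℝ (v k) g)]
  have h4 := mul_le_mul_of_nonneg_left h3 (lam0 k)
  have h5 : lam k * (k ^ 2 * h ^ 2) ≤ L * (k ^ 2 * h ^ 2) :=
    mul_le_mul_of_nonneg_right (hL k) (by positivity)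
  linarith

/-- A vector of norm at most one with a large coordinate is close to a signed basis vector. -/
theorem exists_sign_norm_sub_sq_le (v b : V) (hv : ‖v‖ = 1) (hb : ‖b‖ ≤ 1) :
    ∃ s : ℝ, |s| = 1 ∧ ‖b - s • v‖ ^ 2 ≤ 2 * (1 - inner ℝ v b ^ 2) := by
  have h1 : |inner ℝ v b| ≤ 1 := by simpa using abs_inner_le_of_le hv.le hb
  have h2 : ‖b‖ ^ 2 ≤ 1 := pow_le_one₀ (norm_nonneg _) hb
  rw [abs_le] at h1
  rcases le_total 0 (inner ℝ v b) with h | h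
  · refine ⟨1, by simp, ?_⟩
    rw [one_smul, norm_sub_sq_real, hv, real_inner_comm]
    nlinarith
  · refine ⟨-1, by simp, ?_⟩
    rw [neg_one_smul, sub_neg_eq_add, norm_add_sq_real, hv, real_inner_comm]
    nlinarith

end Perturbation

/-! ### Accuracy of the penalized matrix decomposition. -/

section MatrixDecomposition

variable {n r : ℕ}

theorem inner_toLp_eq_dotProduct (x y : EuclideanSpace ℝ (Fin r)) :
    inner ℝ x y = x.ofLp ⬝ᵥ y.ofLp := by
  rw [EuclideanSpace.inner_eq_star_dotProduct, dotProduct_comm]; simp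

theorem sum_sq_eq_norm_sq (x : EuclideanSpace ℝ (Fin r)) : ∑ i, x.ofLp i ^ 2 = ‖x‖ ^ 2 := by
  rw [EuclideanSpace.norm_sq_eq]; simp

theorem pmdFeasible_norm_le {τ : ℝ} {q : (Fin n → ℝ) × (Fin r → ℝ)} (hq : q ∈ pmdFeasible n r τ) :
    ‖WithLp.toLp 2 q.1‖ ≤ 1 ∧ ‖WithLp.toLp 2 q.2‖ ≤ 1 := by
  constructor <;> refine (pow_le_one_iff_of_nonneg (norm_nonneg _) two_ne_zero).1 ?_ <;>
    rw [← sum_sq_eq_norm_sq]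
  exacts [hq.2.2, hq.2.1]

/-- The matrix factor of a maximizing pair is normed by its left factor. -/
theorem isMaxOn_pmdFeasible {A : Matrix (Fin n) (Fin r) ℝ} {τ : ℝ} {a : Fin n → ℝ} {b : Fin r → ℝ}
    (hab : (a, b) ∈ pmdFeasible n r τ)
    (hmax : IsMaxOn (fun q : (Fin n → ℝ) × (Fin r → ℝ) => q.1 ⬝ᵥ (A *ᵥ q.2))
      (pmdFeasible n r τ) (a, b)) :
    (a ⬝ᵥ (A *ᵥ b)) • a = A *ᵥ b ∧
      ∀ y, l1Norm y ≤ τ → ∑ i, y i ^ 2 ≤ 1 →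
        ∑ i, (A *ᵥ y) i ^ 2 ≤ ∑ i, (A *ᵥ b) i ^ 2 := by
  have hna := (pmdFeasible_norm_le hab).1
  simp only at hna
  have h1 : ∀ y, l1Norm y ≤ τ → ∑ i, y i ^ 2 ≤ 1 →
      ‖WithLp.toLp 2 (A *ᵥ y)‖ ≤ a ⬝ᵥ (A *ᵥ b) := by
    intro y hy1 hy2
    set z : EuclideanSpace ℝ (Fin n) := WithLp.toLp 2 (A *ᵥ y) with hz
    -- The best left factor for `y` is the normalized `A y`; if `A y = 0` the convention `0⁻¹ = 0`
    -- still gives a feasible pair.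
    have hmem : ((‖z‖⁻¹ • z).ofLp, y) ∈ pmdFeasible n r τ := by
      refine ⟨hy1, hy2, ?_⟩
      rw [sum_sq_eq_norm_sq, norm_smul, norm_inv, norm_norm]
      rcases eq_or_ne ‖z‖ 0 with h | h
      · simp [h]
      · simp [h]
    have h2 := hmax hmem
    simp only [Set.mem_ofPred_eq] at h2
    refine le_trans (le_of_eq ?_) h2
    have : (‖z‖⁻¹ • z).ofLp ⬝ᵥ (A *ᵥ y) = inner ℝ (‖z‖⁻¹ • z) z := by
      rw [inner_toLp_eq_dotProduct]
    rw [this, inner_smul_left, conj_trivial, real_inner_self_eq_norm_sq]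
    rcases eq_or_ne ‖z‖ 0 with h | h
    · simp [h]
    · field_simp
  have h2 : a ⬝ᵥ (A *ᵥ b) = inner ℝ (WithLp.toLp 2 a) (WithLp.toLp 2 (A *ᵥ b)) := by
    rw [inner_toLp_eq_dotProduct]
  have hb := h1 b hab.1 hab.2.1
  have h3 : a ⬝ᵥ (A *ᵥ b) ≤ ‖WithLp.toLp 2 (A *ᵥ b)‖ := by
    rw [h2]
    exact (real_inner_le_norm _ _).trans (mul_le_of_le_one_left (norm_nonneg _) hna)
  constructor
  · have h4 : ‖(a ⬝ᵥ (A *ᵥ b)) • WithLp.toLp 2 a - WithLp.toLp 2 (A *ᵥ b)‖ ^ 2 ≤ 0 := by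
      have h6 : a ⬝ᵥ (A *ᵥ b) = ‖WithLp.toLp 2 (A *ᵥ b)‖ := le_antisymm h3 hb
      rw [norm_sub_sq_real, inner_smul_left, conj_trivial, ← h2, norm_smul, mul_pow, h6]
      have := mul_le_mul_of_nonneg_left (pow_le_one₀ (n := 2) (norm_nonneg _) hna)
        (sq_nonneg ‖WithLp.toLp 2 (A *ᵥ b)‖)
      rw [norm_norm]
      nlinarith
    have h5 := pow_eq_zero_iff two_ne_zero |>.1 (le_antisymm h4 (sq_nonneg _))
    rw [norm_eq_zero, sub_eq_zero] at h5
    exact congrArg WithLp.ofLp h5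
  · intro y hy1 hy2
    have h4 := (h1 y hy1 hy2).trans h3
    have := sum_sq_eq_norm_sq (WithLp.toLp 2 (A *ᵥ y))
    have h5 := sum_sq_eq_norm_sq (WithLp.toLp 2 (A *ᵥ b))
    simp only at this h5
    rw [this, h5]
    exact pow_le_pow_left₀ (norm_nonneg _) h4 2

/-- Optimality of `a k` turns the subtracted rank-one matrix into `Xᵏ b_k b_kᵀ`, so the left factors
disappear and deflation acts on the argument alone. -/
theorem deflated_mulVec {X : Matrix (Fin n) (Fin r) ℝ} {τ : ℝ} {d : ℕ} {a : ℕ → Fin n → ℝ}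
    {b : ℕ → Fin r → ℝ} (h : IsPMD X τ d a b) (k : ℕ) (hk : k ≤ d)
    (y : EuclideanSpace ℝ (Fin r)) :
    deflated X a b k *ᵥ y.ofLp = X *ᵥ (deflate (fun j => WithLp.toLp 2 (b j)) k y).ofLp := by
  induction k generalizing y with
  | zero => rfl
  | succ k ih =>
    have h1 := h k (by omega)
    have h2 := (isMaxOn_pmdFeasible h1.1 h1.2).1
    rw [deflated, deflate, ← ih (by omega), Matrix.sub_mulVec, Matrix.smul_mulVec,
      Matrix.vecMulVec_mulVec, inner_toLp_eq_dotProduct, WithLp.ofLp_sub, WithLp.ofLp_smul,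
      Matrix.mulVec_sub, Matrix.mulVec_smul, op_smul_eq_smul, smul_comm, h2]

theorem l1Norm_sub_smul_le (x y : Fin r → ℝ) (c : ℝ) :
    l1Norm (x - c • y) ≤ l1Norm x + |c| * l1Norm y := by
  rw [l1Norm, l1Norm, l1Norm, Finset.mul_sum, ← Finset.sum_add_distrib]
  refine Finset.sum_le_sum fun i _ => ?_
  rw [← abs_mul]
  exact abs_sub _ _

theorem l1Norm_nonneg (x : Fin r → ℝ) : 0 ≤ l1Norm x := Finset.sum_nonneg fun _ _ => abs_nonneg _

theorem l1Norm_deflate_le (x : ℕ → EuclideanSpace ℝ (Fin r)) {τ : ℝ} (k : ℕ)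
    (hx : ∀ j < k, ‖x j‖ ≤ 1) (hx1 : ∀ j < k, l1Norm (x j).ofLp ≤ τ)
    (b : EuclideanSpace ℝ (Fin r)) (hb : ‖b‖ ≤ 1) :
    l1Norm (deflate x k b).ofLp ≤ l1Norm b.ofLp + k * τ := by
  induction k generalizing b with
  | zero => simp [deflate]
  | succ k ih =>
    have h1 := ih (fun j hj => hx j (by omega)) (fun j hj => hx1 j (by omega))
      (b - inner ℝ (x k) b • x k) ((norm_sub_inner_smul_le _ _ (hx k (by omega))).trans hb)
    have h2 := l1Norm_sub_smul_le b.ofLp (x k).ofLp (inner ℝ (x k) b)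
    have h3 : |inner ℝ (x k) b| ≤ 1 := by simpa using abs_inner_le_of_le (hx k (by omega)) hb
    have h4 := mul_le_mul h3 (hx1 k (by omega)) (l1Norm_nonneg _) zero_le_one
    rw [deflate]
    rw [WithLp.ofLp_sub, WithLp.ofLp_smul] at h1
    push_cast
    linarith

theorem abs_dotProduct_mulVec_le (A : Matrix (Fin r) (Fin r) ℝ) {η : ℝ} (hA : ∀ i j, |A i j| ≤ η)
    (z : Fin r → ℝ) : |z ⬝ᵥ (A *ᵥ z)| ≤ l1Norm z ^ 2 * η := by
  simp only [dotProduct, Matrix.mulVec, Finset.mul_sum]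
  refine (Finset.abs_sum_le_sum_abs _ _).trans ?_
  refine (Finset.sum_le_sum fun i _ => Finset.abs_sum_le_sum_abs _ _).trans ?_
  rw [l1Norm, sq, Finset.sum_mul_sum, Finset.sum_mul]
  refine Finset.sum_le_sum fun i _ => ?_
  rw [Finset.sum_mul]
  refine Finset.sum_le_sum fun j _ => ?_
  rw [abs_mul, abs_mul, mul_comm |A i j|, ← mul_assoc]
  exact mul_le_mul_of_nonneg_left (hA i j) (by positivity)

theorem dotProduct_sampleCov_mulVec (X : Matrix (Fin n) (Fin r) ℝ) (z : Fin r → ℝ) :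
    z ⬝ᵥ (sampleCov X X *ᵥ z) = (n : ℝ)⁻¹ * ∑ i, (X *ᵥ z) i ^ 2 := by
  rw [sampleCov, Matrix.smul_mulVec, dotProduct_smul, smul_eq_mul, ← Matrix.mulVec_mulVec,
    Matrix.dotProduct_mulVec, Matrix.vecMul_transpose, dotProduct]
  simp only [sq]

theorem NIECE.IsOrderedEigenbasis.mulVec_eq {M : Matrix (Fin r) (Fin r) ℝ} {lam : Fin r → ℝ}
    {v : OrthonormalBasis (Fin r) ℝ (EuclideanSpace ℝ (Fin r))} (h : IsOrderedEigenbasis M lam v)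
    (z : EuclideanSpace ℝ (Fin r)) :
    M *ᵥ z.ofLp = ∑ i, (lam i * inner ℝ (v i) z) • (v i).ofLp := by
  conv_lhs => rw [← v.sum_repr' z]
  rw [WithLp.ofLp_sum, Matrix.mulVec_sum]
  refine Finset.sum_congr rfl fun i _ => ?_
  rw [WithLp.ofLp_smul, Matrix.mulVec_smul, h.eigen, smul_smul, mul_comm]

theorem NIECE.IsOrderedEigenbasis.dotProduct_mulVec_eq {M : Matrix (Fin r) (Fin r) ℝ} {lam : Fin r → ℝ}
    {v : OrthonormalBasis (Fin r) ℝ (EuclideanSpace ℝ (Fin r))} (h : IsOrderedEigenbasis M lam v)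
    (z : EuclideanSpace ℝ (Fin r)) :
    z.ofLp ⬝ᵥ (M *ᵥ z.ofLp) = ∑ i, lam i * inner ℝ (v i) z ^ 2 := by
  rw [h.mulVec_eq, dotProduct_sum]
  refine Finset.sum_congr rfl fun i _ => ?_
  rw [dotProduct_smul, dotProduct_comm, ← inner_toLp_eq_dotProduct, smul_eq_mul]; ring

/-- The error constant of the `k`-th direction of the penalized matrix decomposition. -/
noncomputable def pmdConst (L D : ℝ) (d k : ℕ) : ℝ :=
  8 * d ^ 2 / D * (44 * L * d ^ 3 / D + 1) ^ k

theorem pmdConst_nonneg {L D : ℝ} (hL : 0 ≤ L) (hD : 0 < D) (d k : ℕ) : 0 ≤ pmdConst L D d k := by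
  unfold pmdConst; positivity

theorem pmdConst_mono {L D : ℝ} (hL : 0 ≤ L) (hD : 0 < D) (d : ℕ) {k l : ℕ} (h : k ≤ l) :
    pmdConst L D d k ≤ pmdConst L D d l := by
  unfold pmdConst
  refine mul_le_mul_of_nonneg_left (pow_le_pow_right₀ ?_ h) (by positivity)
  have : 0 ≤ 44 * L * d ^ 3 / D := by positivity
  linarith

/-- This is the recursion of the induction step; `pmdConst` is chosen geometric in `k` so as to
dominate it. -/
theorem pmdConst_succ {L D : ℝ} (hL : 0 ≤ L) (hD : 0 < D) (d k : ℕ) :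
    4 / D * (11 * L * d ^ 3 * pmdConst L D d k + 2 * d ^ 2) ≤ pmdConst L D d (k + 1) := by
  have h1 : 8 * d ^ 2 / D ≤ pmdConst L D d k := by
    simpa [pmdConst] using pmdConst_mono hL hD d (Nat.zero_le k)
  have h2 : pmdConst L D d (k + 1) = pmdConst L D d k * (44 * L * d ^ 3 / D + 1) := by
    simp only [pmdConst, pow_succ]; ring
  rw [h2]
  have h3 : 4 / D * (11 * L * d ^ 3 * pmdConst L D d k + 2 * d ^ 2) =
    pmdConst L D d k * (44 * L * d ^ 3 / D) + 8 * d ^ 2 / D := by ring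
  linarith

/-- The directions of the penalized matrix decomposition are close to the leading eigenvectors. -/
theorem NIECE.IsPMD.exists_norm_sub_sq_le {Y : Matrix (Fin n) (Fin r) ℝ} {τ η L D : ℝ} {d : ℕ}
    {a : ℕ → Fin n → ℝ} {b : ℕ → Fin r → ℝ} (hY : IsPMD Y τ d a b)
    {M : Matrix (Fin r) (Fin r) ℝ} {lam : Fin r → ℝ}
    {v : OrthonormalBasis (Fin r) ℝ (EuclideanSpace ℝ (Fin r))}
    (hM : IsOrderedEigenbasis M lam v) (lam0 : ∀ i, 0 ≤ lam i) (hL0 : 0 ≤ L) (hL : ∀ i, lam i ≤ L)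
    (hD : 0 < D) (hlamD : ∀ k : Fin r, (k : ℕ) < d → D ≤ lam k)
    (hgap : ∀ k : Fin r, (k : ℕ) < d → ∀ i, k < i → lam i + D ≤ lam k)
    (hv : ∀ k : Fin r, (k : ℕ) < d → l1Norm (v k).ofLp ≤ τ) (hτ : 0 ≤ τ) (hη0 : 0 ≤ η)
    (hη : ∀ i j, |sampleCov Y Y i j - M i j| ≤ η) (k : ℕ) (hk : k ≤ d) :
    ∃ s : ℕ → ℝ, (∀ j, |s j| = 1) ∧ ∀ j : Fin r, (j : ℕ) < k →
      ‖WithLp.toLp 2 (b j) - s j • v j‖ ^ 2 ≤ pmdConst L D d k * (τ ^ 2 * η) := by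
  induction k with
  | zero => exact ⟨fun _ => 1, by simp, by simp⟩
  | succ k ih =>
    obtain ⟨s, hs, hclose⟩ := ih (by omega)
    -- If `r ≤ k` there is no new eigenvector to approximate.
    rcases le_or_gt r k with hrk | hkr
    · refine ⟨s, hs, fun j hj => (hclose j (by omega)).trans ?_⟩
      exact mul_le_mul_of_nonneg_right (pmdConst_mono hL0 hD d k.le_succ) (by positivity)
    set x : ℕ → EuclideanSpace ℝ (Fin r) := fun j => WithLp.toLp 2 (b j) with hx
    set κ : Fin r := ⟨k, hkr⟩ with hκ
    have hκd : (κ : ℕ) < d := by rw [hκ]; simp; omega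
    have hG := pmdConst_nonneg hL0 hD d k
    have hh0 : 0 ≤ pmdConst L D d k * (τ ^ 2 * η) := by positivity
    set h := Real.sqrt (pmdConst L D d k * (τ ^ 2 * η)) with hh
    have hsq : h ^ 2 = pmdConst L D d k * (τ ^ 2 * η) := Real.sq_sqrt hh0
    have hx1 : ∀ j < d, ‖x j‖ ≤ 1 := fun j hj => (pmdFeasible_norm_le (hY j hj).1).2
    have hxl : ∀ j < d, l1Norm (x j).ofLp ≤ τ := fun j hj => (hY j hj).1.1
    have hxw : ∀ j : Fin r, j < κ → ‖x j - s j • v j‖ ≤ h := fun j hj =>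
      Real.le_sqrt_of_sq_le (hclose j hj)
    have hup := quad_deflate_le v lam hM.antitone lam0 hL x s (Real.sqrt_nonneg _) κ
      (hlamD κ hκd) (hgap κ hκd) hD.le (fun j hj => hx1 j (by omega)) hs hxw (x k) (hx1 k (by omega))
    have hlow := le_quad_deflate v lam lam0 hL x s (Real.sqrt_nonneg _) κ
      (fun j hj => hx1 j (by omega)) hs hxw
    rw [← hM.dotProduct_mulVec_eq] at hup hlow
    have hvn := (v.orthonormal.1 κ)
    have hmax := (isMaxOn_pmdFeasible (hY k (by omega)).1 (hY k (by omega)).2).2 (v κ).ofLp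
      (hv κ hκd) (by rw [sum_sq_eq_norm_sq, hvn]; norm_num)
    rw [deflated_mulVec hY k (by omega) (v κ), show b k = (x k).ofLp from rfl,
      deflated_mulVec hY k (by omega) (x k)] at hmax
    have hmax' := mul_le_mul_of_nonneg_left hmax (inv_nonneg.2 (Nat.cast_nonneg (α := ℝ) n))
    rw [← dotProduct_sampleCov_mulVec, ← dotProduct_sampleCov_mulVec] at hmax'
    have herr : ∀ y : EuclideanSpace ℝ (Fin r), ‖y‖ ≤ 1 → l1Norm y.ofLp ≤ τ →
        |(deflate x k y).ofLp ⬝ᵥ (sampleCov Y Y *ᵥ (deflate x k y).ofLp) -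
          (deflate x k y).ofLp ⬝ᵥ (M *ᵥ (deflate x k y).ofLp)| ≤ d ^ 2 * (τ ^ 2 * η) := by
      intro y hy1 hy2
      rw [← dotProduct_sub, ← Matrix.sub_mulVec]
      refine (abs_dotProduct_mulVec_le _ (η := η) (fun i j => hη i j) _).trans ?_
      have h1 := l1Norm_deflate_le x k (fun j hj => hx1 j (by omega))
        (fun j hj => hxl j (by omega)) y hy1
      have h2 : l1Norm (deflate x k y).ofLp ≤ d * τ := by
        have : (k : ℝ) + 1 ≤ d := by exact_mod_cast hk
        nlinarith
      have h3 := pow_le_pow_left₀ (l1Norm_nonneg _) h2 2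
      nlinarith
    have he1 := (abs_le.1 (herr (x k) (hx1 k (by omega)) (hxl k (by omega)))).2
    have he2 := (abs_le.1 (herr (v κ) hvn.le (hv κ hκd))).1
    obtain ⟨s', hs', hclose'⟩ := exists_sign_norm_sub_sq_le (v κ) (x k) hvn (hx1 k (by omega))
    have hfin : 2 * (1 - inner ℝ (v κ) (x k) ^ 2) ≤ pmdConst L D d (k + 1) * (τ ^ 2 * η) := by
      have hkd : (k : ℝ) ≤ d := by exact_mod_cast (by omega : k ≤ d)
      have hd1 : (1 : ℝ) ≤ d := by exact_mod_cast (by omega : 1 ≤ d)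
      have hk0 : (0 : ℝ) ≤ k := Nat.cast_nonneg k
      -- The upper and lower bounds contribute together `4 + 2 + 3 + 2 = 11`.
      have hpoly : (4 * (k : ℝ) ^ 3 + 2 * k + 3 * k ^ 2) + 2 * k ^ 2 ≤ 11 * d ^ 3 := by
        have e3 : (k : ℝ) ^ 3 ≤ d ^ 3 := pow_le_pow_left₀ hk0 hkd 3
        have e2 : (k : ℝ) ^ 2 ≤ d ^ 2 := pow_le_pow_left₀ hk0 hkd 2
        have e4 : (d : ℝ) ^ 2 ≤ d ^ 3 := pow_le_pow_right₀ hd1 (by norm_num)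
        have e5 : (d : ℝ) ≤ d ^ 3 := by simpa using pow_le_pow_right₀ hd1 (show 1 ≤ 3 by norm_num)
        linarith
      -- Optimality of `b k` against `v κ`: the sample error enters once for each of the two
      -- vectors, and `lam κ` cancels.
      have h1 : D / 2 * (1 - inner ℝ (v κ) (x k) ^ 2) ≤
          L * ((4 * (k : ℝ) ^ 3 + 2 * k + 3 * k ^ 2) + 2 * k ^ 2) * h ^ 2 +
            2 * (d ^ 2 * (τ ^ 2 * η)) := by
        have e : ((κ : ℕ) : ℝ) = k := rfl
        have e' : (κ : ℕ) = k := rfl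
        rw [e, e'] at hup hlow
        linarith
      have h2 : L * ((4 * (k : ℝ) ^ 3 + 2 * k + 3 * k ^ 2) + 2 * k ^ 2) * h ^ 2 ≤
          L * (11 * d ^ 3) * h ^ 2 := by gcongr
      rw [hsq] at h2 h1
      have h3 := mul_le_mul_of_nonneg_left (h1.trans (add_le_add_left h2 _))
        (show 0 ≤ 4 / D by positivity)
      have h4 := mul_le_mul_of_nonneg_right (pmdConst_succ hL0 hD d k)
        (show 0 ≤ τ ^ 2 * η by positivity)
      have h5 : 4 / D * (D / 2 * (1 - inner ℝ (v κ) (x k) ^ 2)) =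
        2 * (1 - inner ℝ (v κ) (x k) ^ 2) := by field_simp; ring
      linarith
    refine ⟨Function.update s k s', fun j => ?_, fun j hj => ?_⟩
    · rcases eq_or_ne j k with rfl | hj
      · simpa using hs'
      · simpa [hj] using hs j
    · rcases Nat.lt_succ_iff_lt_or_eq.1 hj with hj | hj
      · rw [Function.update_of_ne hj.ne]
        refine (hclose j hj).trans ?_
        exact mul_le_mul_of_nonneg_right (pmdConst_mono hL0 hD d k.le_succ) (by positivity)
      · have : j = κ := Fin.ext hj
        subst this
        rw [show ((κ : Fin r) : ℕ) = k from rfl, Function.update_self]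
        exact hclose'.trans hfin

end MatrixDecomposition

/-! ### Projections, reducing subspaces and the envelope. -/

section Projections

variable {r p : ℕ}

theorem projMatrix_mulVec (S : Submodule ℝ (EuclideanSpace ℝ (Fin r)))
    (x : EuclideanSpace ℝ (Fin r)) : projMatrix S *ᵥ x.ofLp = (S.starProjection x).ofLp := by
  conv_rhs => rw [← (EuclideanSpace.basisFun (Fin r) ℝ).sum_repr x]
  ext i
  simp [projMatrix, Matrix.mulVec, dotProduct, mul_comm]

theorem matrix_ext_of_basis {A B : Matrix (Fin p) (Fin r) ℝ}
    (v : OrthonormalBasis (Fin r) ℝ (EuclideanSpace ℝ (Fin r)))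
    (h : ∀ i, A *ᵥ (v i).ofLp = B *ᵥ (v i).ofLp) : A = B := by
  refine Matrix.ext_iff_mulVec.2 fun x => ?_
  have : x = ∑ i, inner ℝ (v i) (WithLp.toLp 2 x) • (v i).ofLp := by
    have := congrArg WithLp.ofLp (v.sum_repr' (WithLp.toLp 2 x))
    rw [WithLp.ofLp_sum] at this
    simpa using this.symm
  rw [this, Matrix.mulVec_sum, Matrix.mulVec_sum]
  exact Finset.sum_congr rfl fun i _ => by rw [Matrix.mulVec_smul, Matrix.mulVec_smul, h]

/-- The Hilbert–Schmidt norm does not depend on the orthonormal basis; Parseval and self-adjointness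
of the projections allow the exchange. -/
theorem frobNorm_projMatrix_sub_sq (S T : Submodule ℝ (EuclideanSpace ℝ (Fin r)))
    (v : OrthonormalBasis (Fin r) ℝ (EuclideanSpace ℝ (Fin r))) :
    frobNorm (projMatrix S - projMatrix T) ^ 2 =
      ∑ i, ‖S.starProjection (v i) - T.starProjection (v i)‖ ^ 2 := by
  rw [frobNorm, Real.sq_sqrt (by positivity), Finset.sum_comm]
  set e := EuclideanSpace.basisFun (Fin r) ℝ with he
  have h1 : ∀ j, ∑ i, (projMatrix S - projMatrix T) i j ^ 2 =
      ‖S.starProjection (e j) - T.starProjection (e j)‖ ^ 2 := fun j => by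
    rw [← sum_sq_eq_norm_sq]
    simp [projMatrix, he]
  simp_rw [h1]
  have h2 : ∀ x, ‖S.starProjection x - T.starProjection x‖ ^ 2 =
      ∑ i, inner ℝ (S.starProjection (v i) - T.starProjection (v i)) x ^ 2 := fun x => by
    rw [← sum_inner_sq_eq v]
    refine Finset.sum_congr rfl fun i _ => ?_
    rw [inner_sub_left, inner_sub_right, S.inner_starProjection_left_eq_right,
      T.inner_starProjection_left_eq_right]
  rw [Finset.sum_congr rfl fun j _ => h2 (e j), Finset.sum_comm]
  refine Finset.sum_congr rfl fun i _ => ?_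
  rw [← sum_inner_sq_eq e]
  exact Finset.sum_congr rfl fun j _ => by rw [real_inner_comm]

/-- The trace of a projection is its rank: expand in an orthonormal basis of `S` and swap the sums.
-/
theorem sum_norm_starProjection_sq (S : Submodule ℝ (EuclideanSpace ℝ (Fin r)))
    (v : OrthonormalBasis (Fin r) ℝ (EuclideanSpace ℝ (Fin r))) :
    ∑ i, ‖S.starProjection (v i)‖ ^ 2 = Module.finrank ℝ S := by
  set w := stdOrthonormalBasis ℝ S
  have h1 : ∀ x, ‖S.starProjection x‖ ^ 2 = ∑ l, inner ℝ x (w l : EuclideanSpace ℝ (Fin r)) ^ 2 := by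
    intro x
    rw [S.starProjection_apply, ← Submodule.coe_norm, ← sum_inner_sq_eq w]
    refine Finset.sum_congr rfl fun l _ => ?_
    rw [Submodule.coe_inner, ← S.starProjection_apply, real_inner_comm,
      S.inner_starProjection_left_eq_right, S.starProjection_eq_self_iff.2 (w l).2]
  simp_rw [h1]
  rw [Finset.sum_comm]
  have h2 : ∀ l, ∑ i, inner ℝ (v i) (w l : EuclideanSpace ℝ (Fin r)) ^ 2 = 1 := fun l => by
    rw [sum_inner_sq_eq, ← Submodule.coe_norm, w.orthonormal.1, one_pow]
  simp [h2]

theorem starProjection_span_image (v : OrthonormalBasis (Fin r) ℝ (EuclideanSpace ℝ (Fin r)))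
    (S : Set (Fin r)) [DecidablePred (· ∈ S)] (i : Fin r) :
    (Submodule.span ℝ (v '' S)).starProjection (v i) = if i ∈ S then v i else 0 := by
  split_ifs with hi
  · exact Submodule.starProjection_eq_self_iff.2 (Submodule.subset_span ⟨i, hi, rfl⟩)
  · rw [Submodule.starProjection_apply_eq_zero_iff, Submodule.mem_orthogonal]
    intro y hy
    induction hy using Submodule.span_induction with
    | mem x hx =>
      obtain ⟨j, hj, rfl⟩ := hx
      exact v.orthonormal.2 (fun h => hi (h ▸ hj))
    | zero => exact inner_zero_left _
    | add x y _ _ hx hy => rw [inner_add_left, hx, hy, add_zero]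
    | smul a x _ hx => rw [inner_smul_left, hx, mul_zero]

/-- A subspace of dimension at most `|S|` that nearly contains the basis vectors `v i`, `i ∈ S`,
is close to their span. -/
theorem frobNorm_projMatrix_sub_span_le (v : OrthonormalBasis (Fin r) ℝ (EuclideanSpace ℝ (Fin r)))
    (S : Finset (Fin r)) (T : Submodule ℝ (EuclideanSpace ℝ (Fin r)))
    (hT : Module.finrank ℝ T ≤ S.card) {η : ℝ} (h : ∀ i ∈ S, ∃ y ∈ T, ‖y - v i‖ ^ 2 ≤ η) :
    frobNorm (projMatrix T - projMatrix (Submodule.span ℝ (v '' S))) ^ 2 ≤ 2 * S.card * η := by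
  rw [frobNorm_projMatrix_sub_sq _ _ v]
  set E := Submodule.span ℝ (v '' S) with hE
  have hin : ∀ i ∈ S, E.starProjection (v i) = v i := fun i hi => by
    classical
    rw [hE, starProjection_span_image, if_pos (Finset.mem_coe.2 hi)]
  have hout : ∀ i ∉ S, E.starProjection (v i) = 0 := fun i hi => by
    classical
    rw [hE, starProjection_span_image, if_neg (fun h => hi (Finset.mem_coe.1 h))]
  have hpy : ∀ i, ‖T.starProjection (v i) - v i‖ ^ 2 = 1 - ‖T.starProjection (v i)‖ ^ 2 := by
    intro i
    have h1 := Submodule.norm_sq_eq_add_norm_sq_starProjection (v i) T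
    rw [T.starProjection_orthogonal', v.orthonormal.1 i] at h1
    have h2 : ‖((1 : EuclideanSpace ℝ (Fin r) →L[ℝ] EuclideanSpace ℝ (Fin r)) -
      T.starProjection) (v i)‖ = ‖T.starProjection (v i) - v i‖ := by
      rw [norm_sub_rev]; rfl
    rw [h2] at h1
    linarith
  have hle : ∀ i ∈ S, ‖T.starProjection (v i) - v i‖ ^ 2 ≤ η := by
    intro i hi
    obtain ⟨y, hy, hyη⟩ := h i hi
    have h1 := Submodule.norm_sq_eq_add_norm_sq_starProjection (y - v i) T
    have h2 : Tᗮ.starProjection (y - v i) = T.starProjection (v i) - v i := by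
      rw [T.starProjection_orthogonal']
      have : T.starProjection y = y := T.starProjection_eq_self_iff.2 hy
      simp [this]
    rw [h2] at h1
    nlinarith [sq_nonneg ‖T.starProjection (y - v i)‖]
  -- Written this way, the first terms add up to `dim T ≤ |S|`, which the summands `-1` over `S`
  -- absorb; only twice the distances from `v i` to `T` remains.
  have hterm : ∀ i, ‖T.starProjection (v i) - E.starProjection (v i)‖ ^ 2 =
      ‖T.starProjection (v i)‖ ^ 2 +
        if i ∈ S then 2 * ‖T.starProjection (v i) - v i‖ ^ 2 - 1 else 0 := fun i => by
    by_cases hi : i ∈ S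
    · rw [if_pos hi, hin i hi]; linarith [hpy i]
    · rw [if_neg hi, hout i hi, sub_zero, add_zero]
  simp_rw [hterm]
  rw [Finset.sum_add_distrib, sum_norm_starProjection_sq, ← Finset.sum_filter,
    Finset.filter_mem_eq_inter, Finset.univ_inter]
  have h3 : ∑ i ∈ S, (2 * ‖T.starProjection (v i) - v i‖ ^ 2 - 1) ≤ S.card • (2 * η - 1) :=
    Finset.sum_le_card_nsmul _ _ _ fun i hi => by linarith [hle i hi]
  rw [nsmul_eq_mul] at h3
  have h4 : (Module.finrank ℝ T : ℝ) ≤ S.card := by exact_mod_cast hT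
  linarith

theorem NIECE.IsOrderedEigenbasis.inner_mulVec {M : Matrix (Fin r) (Fin r) ℝ} {lam : Fin r → ℝ}
    {v : OrthonormalBasis (Fin r) ℝ (EuclideanSpace ℝ (Fin r))} (h : IsOrderedEigenbasis M lam v)
    (i : Fin r) (z : EuclideanSpace ℝ (Fin r)) :
    inner ℝ (v i) (WithLp.toLp 2 (M *ᵥ z.ofLp)) = lam i * inner ℝ (v i) z := by
  have : WithLp.toLp 2 (M *ᵥ z.ofLp) = ∑ j, (lam j * inner ℝ (v j) z) • v j := by
    rw [h.mulVec_eq]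
    ext; simp
  rw [this, inner_sum]
  simp_rw [inner_smul_right, orthonormal_iff_ite.1 v.orthonormal i]
  simp

/-- Multiplying the reducing identity by `P` on either side leaves `P M P`. -/
theorem NIECE.IsReducing.mul_comm {M : Matrix (Fin r) (Fin r) ℝ}
    {R : Submodule ℝ (EuclideanSpace ℝ (Fin r))} (h : IsReducing M R) :
    M * projMatrix R = projMatrix R * M := by
  have hP : projMatrix R * projMatrix R = projMatrix R := by
    refine matrix_ext_of_basis (EuclideanSpace.basisFun (Fin r) ℝ) fun i => ?_
    rw [← Matrix.mulVec_mulVec, projMatrix_mulVec, projMatrix_mulVec,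
      R.starProjection_eq_self_iff.2 (R.starProjection_apply_mem _)]
  have h1 : (1 - projMatrix R) * projMatrix R = 0 := by rw [sub_mul, one_mul, hP, sub_self]
  have h2 : projMatrix R * (1 - projMatrix R) = 0 := by rw [mul_sub, mul_one, hP, sub_self]
  have h3 := congrArg (· * projMatrix R) h
  have h4 := congrArg (projMatrix R * ·) h
  simp only [add_mul, mul_assoc, h1, hP, mul_zero, add_zero] at h3
  simp only [mul_add, ← mul_assoc, h2, hP, zero_mul, add_zero] at h4
  rw [h3, h4, mul_assoc]

/-- An eigenvector of a simple eigenvalue lies in a reducing subspace or is orthogonal to it. -/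
theorem mem_or_mem_orthogonal_of_isReducing {M : Matrix (Fin r) (Fin r) ℝ} {lam : Fin r → ℝ}
    {v : OrthonormalBasis (Fin r) ℝ (EuclideanSpace ℝ (Fin r))} (h : IsOrderedEigenbasis M lam v)
    {R : Submodule ℝ (EuclideanSpace ℝ (Fin r))} (hR : IsReducing M R) (k : Fin r)
    (hk : ∀ i ≠ k, lam i ≠ lam k) : v k ∈ R ∨ v k ∈ Rᗮ := by
  have h1 : M *ᵥ (R.starProjection (v k)).ofLp = lam k • (R.starProjection (v k)).ofLp := by
    rw [← projMatrix_mulVec, Matrix.mulVec_mulVec, IsReducing.mul_comm hR, ← Matrix.mulVec_mulVec, h.eigen,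
      Matrix.mulVec_smul]
  -- The projection of `v k` is fixed by `M` up to `lam k`, and that eigenspace is a line, so it is
  -- a multiple of `v k`.
  have h2 : ∀ i ≠ k, inner ℝ (v i) (R.starProjection (v k)) = 0 := fun i hi => by
    have h3 := h.inner_mulVec i (R.starProjection (v k))
    rw [h1, WithLp.toLp_smul, inner_smul_right] at h3
    have h4 : (lam i - lam k) * inner ℝ (v i) (R.starProjection (v k)) = 0 := by
      rw [sub_mul, sub_eq_zero]; exact h3.symm
    exact (mul_eq_zero.1 h4).resolve_left (sub_ne_zero.2 (hk i hi))
  set c := inner ℝ (v k) (R.starProjection (v k)) with hc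
  have h3 : R.starProjection (v k) = c • v k := by
    rw [← v.sum_repr' (R.starProjection (v k)), Finset.sum_eq_single k]
    · exact fun i _ hi => by rw [h2 i hi, zero_smul]
    · exact fun h => (h (Finset.mem_univ _)).elim
  rcases eq_or_ne c 0 with h0 | h0
  · right
    rw [← R.starProjection_apply_eq_zero_iff, h3, h0, zero_smul]
  · left
    have : v k = c⁻¹ • R.starProjection (v k) := by rw [h3, smul_smul, inv_mul_cancel₀ h0, one_smul]
    rw [this]
    exact R.smul_mem _ (R.starProjection_apply_mem _)

theorem isReducing_span_eigenvectors {M : Matrix (Fin r) (Fin r) ℝ} {lam : Fin r → ℝ}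
    {v : OrthonormalBasis (Fin r) ℝ (EuclideanSpace ℝ (Fin r))} (h : IsOrderedEigenbasis M lam v)
    (S : Set (Fin r)) : IsReducing M (Submodule.span ℝ (v '' S)) := by
  classical
  refine matrix_ext_of_basis v fun i => ?_
  simp only [Matrix.add_mulVec, ← Matrix.mulVec_mulVec, Matrix.sub_mulVec, Matrix.one_mulVec,
    projMatrix_mulVec, starProjection_span_image]
  by_cases hi : i ∈ S
  · simp [hi, h.eigen, Matrix.mulVec_smul, projMatrix_mulVec, starProjection_span_image]
  · simp [hi, h.eigen, Matrix.mulVec_smul, projMatrix_mulVec, starProjection_span_image]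

/-- The envelope is spanned by the leading eigenvectors that are not orthogonal to the columns. -/
theorem envelope_eq_span {M : Matrix (Fin r) (Fin r) ℝ} {lam : Fin r → ℝ}
    {v : OrthonormalBasis (Fin r) ℝ (EuclideanSpace ℝ (Fin r))} (h : IsOrderedEigenbasis M lam v)
    (A : Matrix (Fin r) (Fin p) ℝ) (D S : Set (Fin r)) (hk : ∀ k ∈ D, ∀ i ≠ k, lam i ≠ lam k)
    (hS : ∀ i, i ∈ S ↔ i ∈ D ∧ Aᵀ *ᵥ (v i).ofLp ≠ 0)
    (hE : envelope M A ≤ Submodule.span ℝ (v '' D)) :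
    envelope M A = Submodule.span ℝ (v '' S) := by
  classical
  have hcol : ∀ i j, inner ℝ (v i) (WithLp.toLp 2 fun l => A l j) = (Aᵀ *ᵥ (v i).ofLp) j := by
    intro i j
    rw [inner_toLp_eq_dotProduct, dotProduct_comm]; rfl
  refine le_antisymm (sInf_le ⟨isReducing_span_eigenvectors h S, ?_⟩) (le_sInf ?_)
  · refine Submodule.span_le.2 ?_
    rintro _ ⟨j, rfl⟩
    set x : EuclideanSpace ℝ (Fin r) := WithLp.toLp 2 fun l => A l j with hx
    have hmem : x ∈ Submodule.span ℝ (v '' D) := by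
      refine hE ((Submodule.mem_sInf).2 fun R hR => hR.2 (Submodule.subset_span ⟨j, rfl⟩))
    -- Off `D` the coordinate vanishes because the columns lie in the envelope, hence in the span
    -- over `D`; in `D` but off `S` it is an entry of `Aᵀ v i = 0`.
    have hzero : ∀ i ∉ S, inner ℝ (v i) x = 0 := fun i hi => by
      by_cases hD : i ∈ D
      · have : Aᵀ *ᵥ (v i).ofLp = 0 := by
          by_contra hne
          exact hi ((hS i).2 ⟨hD, hne⟩)
        rw [hcol, this]; rfl
      · rw [← Submodule.starProjection_eq_self_iff.2 hmem,
          ← Submodule.inner_starProjection_left_eq_right, starProjection_span_image, if_neg hD,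
          inner_zero_left]
    change x ∈ _
    rw [← v.sum_repr' x]
    refine Submodule.sum_mem _ fun i _ => ?_
    by_cases hi : i ∈ S
    · exact Submodule.smul_mem _ _ (Submodule.subset_span ⟨i, hi, rfl⟩)
    · rw [hzero i hi, zero_smul]; exact Submodule.zero_mem _
  · rintro R ⟨hR, hAR⟩
    refine Submodule.span_le.2 ?_
    rintro _ ⟨k, hkS, rfl⟩
    obtain ⟨hkD, hne⟩ := (hS k).1 hkS
    refine (mem_or_mem_orthogonal_of_isReducing h hR k (hk k hkD)).resolve_right fun hort => hne ?_
    ext j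
    rw [← hcol, real_inner_comm]
    exact (Submodule.mem_orthogonal _ _).1 hort _ (hAR (Submodule.subset_span ⟨j, rfl⟩))

theorem finrank_span_orthonormalBasis_image
    (v : OrthonormalBasis (Fin r) ℝ (EuclideanSpace ℝ (Fin r))) (S : Finset (Fin r)) :
    Module.finrank ℝ (Submodule.span ℝ (v '' S)) = S.card := by
  classical
  have h := sum_norm_starProjection_sq (Submodule.span ℝ (v '' S)) v
  have h1 : ∀ i, ‖(Submodule.span ℝ (v '' S)).starProjection (v i)‖ ^ 2 =
      if i ∈ S then 1 else 0 := fun i => by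
    rw [starProjection_span_image]
    by_cases hi : i ∈ S <;> simp [hi]
  simp_rw [h1] at h
  rw [← Nat.cast_inj (R := ℝ), ← h]
  simp

end Projections

/-! ### Ranking by scores and perturbation of scores. -/

section Scores

variable {n r p d : ℕ}

theorem succ_le_card_of_forall_le (π : Equiv.Perm (Fin d)) (T : Finset (Fin d)) (j : Fin d)
    (h : ∀ i ≤ j, π i ∈ T) : (j : ℕ) + 1 ≤ T.card := by
  have h1 : (Finset.Iic j).map π.toEmbedding ⊆ T := by
    intro x hx
    obtain ⟨i, hi, rfl⟩ := Finset.mem_map.1 hx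
    exact h i (Finset.mem_Iic.1 hi)
  simpa using Finset.card_le_card h1

/-- The first `|T|` indices of a descending arrangement include `T` if the values on `T` exceed
the others. -/
theorem symm_apply_lt_card {f : Fin d → ℝ} {π : Equiv.Perm (Fin d)} (hf : Antitone fun k => f (π k))
    (T : Finset (Fin d)) (hT : ∀ k ∈ T, ∀ l ∉ T, f l < f k) (k : Fin d) (hk : k ∈ T) :
    (π.symm k : ℕ) < T.card := by
  -- Every position up to that of `k` holds an element of `T`, since an outsider there would have a
  -- value at least `f k`.
  refine Nat.lt_of_succ_le (succ_le_card_of_forall_le π T _ fun i hi => ?_)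
  by_contra hne
  have h1 := hf hi
  simp only [Equiv.apply_symm_apply] at h1
  exact absurd (hT k hk _ hne) (not_lt.2 h1)

/-- If exactly `u` of the nonnegative scores are nonzero, the score gap is at most each of them. -/
theorem scoreGap_le {φ : Fin d → ℝ} (hφ : ∀ k, 0 ≤ φ k) (T : Finset (Fin d))
    (hT : ∀ k, k ∈ T ↔ φ k ≠ 0) (k : Fin d) (hk : k ∈ T) : scoreGap φ T.card ≤ φ k := by
  have hanti : Antitone fun j => φ (Tuple.sort (fun k => -φ k) j) := fun i j hij => by
    have := Tuple.monotone_sort (fun k => -φ k) hij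
    simp only [Function.comp_apply] at this
    linarith
  have hlt := symm_apply_lt_card hanti T (fun k hk l hl => by
    have h1 : φ l = 0 := by by_contra h; exact hl ((hT l).2 h)
    rw [h1]; exact lt_of_le_of_ne (hφ k) (Ne.symm ((hT k).1 hk))) k hk
  have hcard : T.card ≤ d := by simpa using T.card_le_univ
  -- The default value `0` covers `T.card = d`.
  have h0 : 0 ≤ ordered φ T.card := by
    unfold ordered; split_ifs
    exacts [hφ _, le_rfl]
  have h1 : ordered φ (T.card - 1) ≤ φ k := by
    have hlt' : T.card - 1 < d := by omega
    rw [ordered, dif_pos hlt']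
    have := hanti (show (Tuple.sort fun k => -φ k).symm k ≤ ⟨T.card - 1, hlt'⟩ from
      Fin.le_def.2 (Nat.le_sub_one_of_lt hlt))
    simpa using this
  unfold scoreGap
  linarith

theorem score_mul_transpose (A : Matrix (Fin r) (Fin p) ℝ) (x : Fin r → ℝ) :
    score (A * Aᵀ) x = ‖WithLp.toLp 2 (Aᵀ *ᵥ x)‖ ^ 2 := by
  rw [score, ← Matrix.mulVec_mulVec, Matrix.dotProduct_mulVec, ← Matrix.mulVec_transpose,
    ← real_inner_self_eq_norm_sq, inner_toLp_eq_dotProduct]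

theorem opNorm_nonneg (A : Matrix (Fin r) (Fin r) ℝ) : 0 ≤ opNorm A := norm_nonneg _

theorem norm_transpose_mulVec_sq_le (A : Matrix (Fin r) (Fin p) ℝ)
    (x : EuclideanSpace ℝ (Fin r)) :
    ‖WithLp.toLp 2 (Aᵀ *ᵥ x.ofLp)‖ ^ 2 ≤ opNorm (A * Aᵀ) * ‖x‖ ^ 2 := by
  rw [← score_mul_transpose, score]
  have h1 : x.ofLp ⬝ᵥ ((A * Aᵀ) *ᵥ x.ofLp) =
      inner ℝ x (Matrix.toEuclideanCLM (𝕜 := ℝ) (n := Fin r) (A * Aᵀ) x) := by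
    rw [inner_toLp_eq_dotProduct, Matrix.ofLp_toEuclideanCLM]
  rw [h1, opNorm]
  refine (real_inner_le_norm _ _).trans ?_
  have := (Matrix.toEuclideanCLM (𝕜 := ℝ) (n := Fin r) (A * Aᵀ)).le_opNorm x
  nlinarith [norm_nonneg x]

theorem norm_mulVec_le_of_abs_le (B : Matrix (Fin p) (Fin r) ℝ) {η : ℝ} (hη : 0 ≤ η)
    (hB : ∀ i j, |B i j| ≤ η) (x : Fin r → ℝ) :
    ‖WithLp.toLp 2 (B *ᵥ x)‖ ≤ Real.sqrt p * (η * l1Norm x) := by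
  have h0 : 0 ≤ η * l1Norm x := mul_nonneg hη (l1Norm_nonneg x)
  refine le_of_sq_le_sq ?_ (by positivity)
  rw [← sum_sq_eq_norm_sq, mul_pow, Real.sq_sqrt (Nat.cast_nonneg p)]
  have h1 : ∀ i ∈ Finset.univ, (B *ᵥ x) i ^ 2 ≤ (η * l1Norm x) ^ 2 := fun i _ => by
    refine sq_le_sq.2 (le_trans ?_ (le_abs_self _))
    rw [Matrix.mulVec, dotProduct, l1Norm, Finset.mul_sum]
    refine (Finset.abs_sum_le_sum_abs _ _).trans (Finset.sum_le_sum fun j _ => ?_)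
    rw [abs_mul]
    exact mul_le_mul_of_nonneg_right (hB i j) (abs_nonneg _)
  simpa using Finset.sum_le_card_nsmul _ _ _ h1

theorem sampleCov_transpose (X : Matrix (Fin n) (Fin p) ℝ) (Y : Matrix (Fin n) (Fin r) ℝ) :
    (sampleCov Y X)ᵀ = sampleCov X Y := by
  simp [sampleCov, Matrix.transpose_smul, Matrix.transpose_mul]

theorem finrank_span_lt_le {V : Type*} [AddCommGroup V] [Module ℝ V] (f : Fin d → V) (u : ℕ) :
    Module.finrank ℝ (Submodule.span ℝ {x | ∃ k : Fin d, (k : ℕ) < u ∧ x = f k}) ≤ u := by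
  classical
  have h1 : {x | ∃ k : Fin d, (k : ℕ) < u ∧ x = f k} =
      (((Finset.univ.filter fun k : Fin d => (k : ℕ) < u).image f : Finset V) : Set V) := by
    ext x; simp [eq_comm]
  rw [h1]
  refine (finrank_span_finset_le_card _).trans (Finset.card_image_le.trans ?_)
  rw [Fin.card_filter_val_lt]
  exact min_le_right _ _

theorem range_leading (hdr : d ≤ r)
    (v : OrthonormalBasis (Fin r) ℝ (EuclideanSpace ℝ (Fin r))) :
    Set.range (leading hdr v) = v '' {i | (i : ℕ) < d} := by
  ext x
  constructor
  · rintro ⟨k, rfl⟩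
    exact ⟨Fin.castLE hdr k, k.2, rfl⟩
  · rintro ⟨i, hi, rfl⟩
    exact ⟨⟨i, hi⟩, rfl⟩

/-- The score of an estimated direction is within the perturbation radius of the true one. -/
theorem abs_norm_transpose_mulVec_sub_le (A B : Matrix (Fin r) (Fin p) ℝ) {η h τ : ℝ} (hη : 0 ≤ η)
    (hAB : ∀ i j, |Bᵀ i j - Aᵀ i j| ≤ η) (x w : EuclideanSpace ℝ (Fin r)) (hxw : ‖x - w‖ ≤ h)
    (hx : l1Norm x.ofLp ≤ τ) :
    |‖WithLp.toLp 2 (Bᵀ *ᵥ x.ofLp)‖ - ‖WithLp.toLp 2 (Aᵀ *ᵥ w.ofLp)‖| ≤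
      Real.sqrt (opNorm (A * Aᵀ)) * h + Real.sqrt p * (η * τ) := by
  have h1 := norm_mulVec_le_of_abs_le (Bᵀ - Aᵀ) hη hAB x.ofLp
  have h2 := norm_transpose_mulVec_sq_le A (x - w)
  have h3 : ‖WithLp.toLp 2 (Aᵀ *ᵥ (x - w).ofLp)‖ ≤ Real.sqrt (opNorm (A * Aᵀ)) * h := by
    refine (Real.le_sqrt_of_sq_le h2).trans ?_
    rw [Real.sqrt_mul (opNorm_nonneg _), Real.sqrt_sq (norm_nonneg _)]
    exact mul_le_mul_of_nonneg_left hxw (Real.sqrt_nonneg _)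
  -- The `ℓ₂`-small change of direction meets the population matrix, while the entrywise small
  -- matrix error meets the `ℓ₁`-bounded vector.
  have h4 : WithLp.toLp 2 (Bᵀ *ᵥ x.ofLp) - WithLp.toLp 2 (Aᵀ *ᵥ w.ofLp) =
      WithLp.toLp 2 (Aᵀ *ᵥ (x - w).ofLp) + WithLp.toLp 2 ((Bᵀ - Aᵀ) *ᵥ x.ofLp) := by
    rw [WithLp.ofLp_sub, Matrix.mulVec_sub, Matrix.sub_mulVec, WithLp.toLp_sub, WithLp.toLp_sub]
    abel
  refine (_root_.abs_norm_sub_norm_le _ _).trans ?_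
  rw [h4]
  refine (norm_add_le _ _).trans (add_le_add h3 (h1.trans ?_))
  gcongr

end Scores

/-! ### Estimation error on the accuracy event. -/

section Deterministic

variable {n r p d : ℕ}

theorem minEigenGap_le (lam : Fin r → ℝ) (k : Fin d) :
    minEigenGap lam d ≤ eigSeq lam k - eigSeq lam (k + 1) :=
  ciInf_le (Set.finite_range fun j : Fin d => eigSeq lam j - eigSeq lam (j + 1)).bddBelow k

theorem le_maxL1 (v : Fin d → EuclideanSpace ℝ (Fin r)) (k : Fin d) :
    l1Norm (v k).ofLp ≤ maxL1 v :=
  le_ciSup (Set.finite_range fun k : Fin d => l1Norm (v k).ofLp).bddAbove k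

theorem add_minEigenGap_le {lam : Fin r → ℝ} (hanti : Antitone lam) (k : Fin r)
    (hk : (k : ℕ) < d) (i : Fin r) (hi : k < i) : lam i + minEigenGap lam d ≤ lam k := by
  have h1 := minEigenGap_le lam (⟨k, hk⟩ : Fin d)
  have h2 : (k : ℕ) + 1 < r := by have := i.2; have := Fin.lt_def.1 hi; omega
  simp only [eigSeq, k.2, h2, dif_pos] at h1
  have h3 : lam i ≤ lam ⟨k + 1, h2⟩ := hanti (Fin.le_def.2 (Fin.lt_def.1 hi))
  linarith

theorem minEigenGap_le_of_lt {lam : Fin r → ℝ} (lam0 : ∀ i, 0 ≤ lam i) (k : Fin r)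
    (hk : (k : ℕ) < d) : minEigenGap lam d ≤ lam k := by
  have h1 := minEigenGap_le lam (⟨k, hk⟩ : Fin d)
  have h2 : 0 ≤ eigSeq lam (k + 1) := by
    unfold eigSeq; split_ifs
    exacts [lam0 _, le_rfl]
  have h3 : eigSeq lam (k : ℕ) = lam k := by simp [eigSeq]
  simp only at h1
  linarith

/-- Use `(a + b)² ≤ 2a² + 2b²`. The choice of `δ` makes `8a² ≤ 2 c₀ ν τ² ε`, and `p * ε ≤ 1` absorbs
the dimension factor of `b`. -/
theorem four_mul_error_sq_le {ν G τ δ ε c₀ : ℝ} (hν : 0 ≤ ν) (hG : 0 ≤ G) (hδ : 0 ≤ δ)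
    (hδ' : δ ≤ 1 / 4) (hGδ : 4 * G * δ ≤ c₀) (hε : 0 ≤ ε) (hpε : p * ε ≤ 1) :
    4 * (Real.sqrt ν * Real.sqrt (G * (τ ^ 2 * (δ * ε))) + Real.sqrt p * (δ * ε * τ)) ^ 2 ≤
      (2 * c₀ * ν + 1) * τ ^ 2 * ε := by
  set a := Real.sqrt ν * Real.sqrt (G * (τ ^ 2 * (δ * ε)))
  set b := Real.sqrt p * (δ * ε * τ)
  have ha : a ^ 2 = G * δ * (ν * (τ ^ 2 * ε)) := by
    rw [mul_pow, Real.sq_sqrt hν, Real.sq_sqrt (by positivity)]; ring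
  have hb : b ^ 2 = δ ^ 2 * ((p * ε) * (τ ^ 2 * ε)) := by
    rw [mul_pow, Real.sq_sqrt (Nat.cast_nonneg p)]; ring
  have h0 : 0 ≤ τ ^ 2 * ε := by positivity
  have h1 : 4 * (G * δ) * (ν * (τ ^ 2 * ε)) ≤ c₀ * (ν * (τ ^ 2 * ε)) :=
    mul_le_mul_of_nonneg_right (by linarith) (by positivity)
  have h2 : (p * ε) * (τ ^ 2 * ε) ≤ 1 * (τ ^ 2 * ε) := mul_le_mul_of_nonneg_right hpε h0
  have h3 : δ ^ 2 ≤ 1 / 16 := by nlinarith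
  have h4 : b ^ 2 ≤ 1 / 16 * (1 * (τ ^ 2 * ε)) := by
    rw [hb]
    exact mul_le_mul h3 h2 (by positivity) (by norm_num)
  nlinarith [sq_nonneg (a - b)]

/-- The estimation error of sparse NIECE when all sample covariances are accurate. -/
theorem frobNorm_sparseNIECE_sub_envelope_le (hdr : d ≤ r) {u : ℕ} {ε τ δ L Δ c₀ : ℝ}
    {M : Matrix (Fin r) (Fin r) ℝ} {A : Matrix (Fin r) (Fin p) ℝ} {lam : Fin r → ℝ}
    {v : OrthonormalBasis (Fin r) ℝ (EuclideanSpace ℝ (Fin r))}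
    (hM : IsOrderedEigenbasis M lam v) (lam0 : ∀ i, 0 ≤ lam i) (hL0 : 0 ≤ L) (hL : ∀ i, lam i ≤ L)
    (hΔ : 0 < Δ) (hgap : minEigenGap lam d = Δ)
    (hu : Module.finrank ℝ (envelope M A) = u)
    (hE : envelope M A ≤ Submodule.span ℝ (Set.range (leading hdr v)))
    (hε : 0 < ε) (hεp : ε ≤ 1 / (p : ℝ)) (hτ : maxL1 (leading hdr v) < τ)
    (hscore : (2 * c₀ * opNorm (A * Aᵀ) + 1) * τ ^ 2 * ε <
      scoreGap (fun k => score (A * Aᵀ) (leading hdr v k).ofLp) u)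
    (hδ : 0 ≤ δ) (hδ' : δ ≤ 1 / 4) (hGδ : 4 * pmdConst L Δ d d * δ ≤ c₀)
    {X : Matrix (Fin n) (Fin p) ℝ} {Y : Matrix (Fin n) (Fin r) ℝ}
    (hYY : ∀ i j, |sampleCov Y Y i j - M i j| ≤ δ * ε)
    (hXY : ∀ i j, |sampleCov X Y i j - Aᵀ i j| ≤ δ * ε)
    {Ehat : Submodule ℝ (EuclideanSpace ℝ (Fin r))} (hEhat : IsSparseNIECE X Y τ d u Ehat) :
    frobNorm (projMatrix Ehat - projMatrix (envelope M A)) ^ 2 ≤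
      2 * d * (pmdConst L Δ d d * (τ ^ 2 * (δ * ε))) := by
  classical
  obtain ⟨a, b, π, hpmd, hanti, rfl⟩ := hEhat
  have hτ0 : 0 ≤ τ := (Real.iSup_nonneg fun k => l1Norm_nonneg _).trans hτ.le
  have hδε : 0 ≤ δ * ε := by positivity
  have hG := pmdConst_nonneg hL0 hΔ d d
  have hpε : p * ε ≤ 1 := by
    rcases Nat.eq_zero_or_pos p with rfl | hp
    · simp
    · rw [mul_comm]; exact (le_div_iff₀ (Nat.cast_pos.2 hp)).1 hεp
  have hgap' : ∀ k : Fin r, (k : ℕ) < d → ∀ i, k < i → lam i + Δ ≤ lam k := fun k hk i hi =>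
    hgap ▸ add_minEigenGap_le hM.antitone k hk i hi
  obtain ⟨s, hs, hclose⟩ := hpmd.exists_norm_sub_sq_le hM lam0 hL0 hL hΔ
    (fun k hk => hgap ▸ minEigenGap_le_of_lt lam0 k hk) hgap'
    (fun k hk => (le_maxL1 (leading hdr v) ⟨k, hk⟩).trans hτ.le) hτ0 hδε hYY d le_rfl
  -- the indices of the eigenvectors that span the envelope
  set T : Finset (Fin d) := Finset.univ.filter fun k => Aᵀ *ᵥ (leading hdr v k).ofLp ≠ 0 with hT
  set S : Finset (Fin r) := T.map (Fin.castLEEmb hdr) with hS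
  have hEeq : envelope M A = Submodule.span ℝ (v '' S) := by
    refine envelope_eq_span hM A {i | (i : ℕ) < d} S (fun k hk i hi => ?_) (fun i => ?_)
      (by rwa [← range_leading hdr v])
    · rcases lt_or_gt_of_ne hi with h | h
      · have := hgap' i ((Fin.lt_def.1 h).trans hk) k h
        linarith
      · have := hgap' k hk i h
        linarith
    · rw [Finset.mem_coe, hS, Finset.mem_map]
      constructor
      · rintro ⟨k, hk, rfl⟩
        exact ⟨k.2, (Finset.mem_filter.1 hk).2⟩
      · rintro ⟨hi, hne⟩
        exact ⟨⟨i, hi⟩, Finset.mem_filter.2 ⟨Finset.mem_univ _, hne⟩, rfl⟩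
  have hTu : T.card = u := by
    rw [← hu, hEeq, finrank_span_orthonormalBasis_image, hS, Finset.card_map]
  set φ : Fin d → ℝ := fun k => score (A * Aᵀ) (leading hdr v k).ofLp with hφ
  have hφsq : ∀ k, φ k = ‖WithLp.toLp 2 (Aᵀ *ᵥ (leading hdr v k).ofLp)‖ ^ 2 := fun k =>
    score_mul_transpose _ _
  have hTφ : ∀ k, k ∈ T ↔ φ k ≠ 0 := fun k => by
    rw [hφsq, hT, Finset.mem_filter]; simp
  have hφT : ∀ k ∈ T, (2 * c₀ * opNorm (A * Aᵀ) + 1) * τ ^ 2 * ε < φ k := fun k hk =>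
    hscore.trans_le (hTu ▸ scoreGap_le (fun k => by rw [hφsq]; positivity) T hTφ k hk)
  set h := Real.sqrt (pmdConst L Δ d d * (τ ^ 2 * (δ * ε))) with hh
  set e := Real.sqrt (opNorm (A * Aᵀ)) * h + Real.sqrt p * (δ * ε * τ) with he
  have he0 : 0 ≤ e := by positivity
  have he4 : 4 * e ^ 2 ≤ (2 * c₀ * opNorm (A * Aᵀ) + 1) * τ ^ 2 * ε :=
    four_mul_error_sq_le (opNorm_nonneg _) hG hδ hδ' hGδ hε.le hpε
  have hclose' : ∀ k : Fin d, ‖WithLp.toLp 2 (b k) - s k • leading hdr v k‖ ^ 2 ≤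
      pmdConst L Δ d d * (τ ^ 2 * (δ * ε)) := fun k => hclose (Fin.castLE hdr k) k.2
  have hnorm : ∀ k : Fin d, |‖WithLp.toLp 2 ((sampleCov Y X)ᵀ *ᵥ b k)‖ -
      ‖WithLp.toLp 2 (Aᵀ *ᵥ (leading hdr v k).ofLp)‖| ≤ e := fun k => by
    have h1 := abs_norm_transpose_mulVec_sub_le A (sampleCov Y X) hδε
      (by rwa [sampleCov_transpose]) (WithLp.toLp 2 (b k)) (s k • leading hdr v k)
      (Real.le_sqrt_of_sq_le (hclose' k)) (hpmd k k.2).1.1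
    rw [WithLp.ofLp_smul, Matrix.mulVec_smul, WithLp.toLp_smul, norm_smul, Real.norm_eq_abs, hs,
      one_mul] at h1
    exact h1
  have hsel : ∀ k ∈ T, ∀ l ∉ T, score (sampleCov Y X * sampleCov X Y) (b l) <
      score (sampleCov Y X * sampleCov X Y) (b k) := by
    intro k hk l hl
    rw [← sampleCov_transpose X Y, score_mul_transpose, score_mul_transpose]
    have hl0 : Aᵀ *ᵥ (leading hdr v l).ofLp = 0 := by
      by_contra hne
      exact hl (Finset.mem_filter.2 ⟨Finset.mem_univ _, hne⟩)
    have h1 := hnorm l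
    rw [hl0, WithLp.toLp_zero, norm_zero, sub_zero] at h1
    have h2 := (abs_le.1 (hnorm k)).1
    have h3 := he4.trans_lt (hφT k hk)
    rw [hφsq] at h3
    -- So the sample norm exceeds `e` on `T` and is at most `e` off `T`.
    have h4 : 2 * e < ‖WithLp.toLp 2 (Aᵀ *ᵥ (leading hdr v k).ofLp)‖ :=
      lt_of_pow_lt_pow_left₀ 2 (norm_nonneg _) (by linarith [mul_pow 2 e 2])
    refine pow_lt_pow_left₀ ?_ (norm_nonneg _) two_ne_zero
    linarith [(abs_le.1 h1).2]
  rw [hEeq]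
  have hSu : S.card = u := by rw [hS, Finset.card_map, hTu]
  refine (frobNorm_projMatrix_sub_span_le v S _ ((finrank_span_lt_le _ u).trans hSu.ge)
    (η := pmdConst L Δ d d * (τ ^ 2 * (δ * ε))) fun i hi => ?_).trans ?_
  · obtain ⟨k, hk, rfl⟩ := Finset.mem_map.1 hi
    have hlt := symm_apply_lt_card hanti T hsel k hk
    refine ⟨s k • WithLp.toLp 2 (b k), Submodule.smul_mem _ _ (Submodule.subset_span
      ⟨π.symm k, hTu ▸ hlt, by rw [Equiv.apply_symm_apply]⟩), ?_⟩
    have h1 : s k • WithLp.toLp 2 (b k) - v (Fin.castLEEmb hdr k) =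
        s k • (WithLp.toLp 2 (b k) - s k • leading hdr v k) := by
      rw [smul_sub, smul_smul, ← abs_mul_abs_self, hs, one_mul, one_smul]; rfl
    rw [h1, norm_smul, Real.norm_eq_abs, hs, one_mul]
    exact hclose' k
  · have h1 : (S.card : ℝ) ≤ d := by
      rw [hS, Finset.card_map]; exact_mod_cast (by simpa using T.card_le_univ)
    gcongr

end Deterministic

/-! ### Concentration of sample second moments. -/

section Concentration

/-- The tail bound `P(|Z| ≥ t) ≤ 2 exp(-t²/σ²)` for all `t ≥ 0`. -/
def HasGaussianTail {Ω : Type*} [MeasurableSpace Ω] (Z : Ω → ℝ) (P : Measure Ω) (σ : ℝ) : Prop :=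
  ∀ t : ℝ, 0 ≤ t → P.real {ω | t ≤ |Z ω|} ≤ 2 * Real.exp (-t ^ 2 / σ ^ 2)

variable {Ω₀ : Type*} [MeasurableSpace Ω₀] {P : Measure Ω₀} [IsProbabilityMeasure P]

/-- Layer-cake formula for `Z²`. With `a = 1 / (2σ²)` the tail is `2 exp(-2at)`, so against the
density `a exp(at)` it integrates to `2`; the remaining `1` is the total mass. -/
theorem lintegral_exp_sq_le {Z : Ω₀ → ℝ} (hZ : Measurable Z) {σ : ℝ} (hσ : 0 < σ)
    (h : HasGaussianTail Z P σ) :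
    ∫⁻ ω, ENNReal.ofReal (Real.exp ((2 * σ ^ 2)⁻¹ * Z ω ^ 2)) ∂P ≤ 3 := by
  set a : ℝ := (2 * σ ^ 2)⁻¹ with ha
  have ha0 : 0 < a := by positivity
  have hcont : Continuous fun t : ℝ => a * Real.exp (a * t) := by fun_prop
  have h1 := lintegral_comp_eq_lintegral_meas_le_mul P (f := fun ω => Z ω ^ 2)
    (g := fun t => a * Real.exp (a * t)) (Filter.Eventually.of_forall fun ω => sq_nonneg (Z ω))
    (hZ.pow_const 2).aemeasurable (fun t _ => hcont.intervalIntegrable 0 t)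
    (Filter.Eventually.of_forall fun t => by positivity)
  have h2 : ∀ x : ℝ, ∫ t in (0 : ℝ)..x, a * Real.exp (a * t) = Real.exp (a * x) - 1 := fun x => by
    simp
  simp_rw [h2] at h1
  have h3 : ∀ t ∈ Set.Ioi (0 : ℝ), P {ω | t ≤ Z ω ^ 2} * ENNReal.ofReal (a * Real.exp (a * t)) ≤
      ENNReal.ofReal (2 * a * Real.exp (-a * t)) := by
    intro t ht
    have ht0 : 0 ≤ t := le_of_lt ht
    have h4 : {ω | t ≤ Z ω ^ 2} = {ω | Real.sqrt t ≤ |Z ω|} := by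
      ext ω
      simp only [Set.mem_ofPred_eq]
      rw [Real.sqrt_le_left (abs_nonneg _), sq_abs]
    rw [h4, ← ofReal_measureReal, ← ENNReal.ofReal_mul measureReal_nonneg]
    refine ENNReal.ofReal_le_ofReal ?_
    refine (mul_le_mul_of_nonneg_right (h _ (Real.sqrt_nonneg t)) (by positivity)).trans_eq ?_
    rw [Real.sq_sqrt ht0]
    have : -t / σ ^ 2 = -a * t + -(a * t) := by rw [ha]; field_simp; ring
    rw [this, Real.exp_add, Real.exp_neg (a * t)]
    field_simp
  have h5 : ∫⁻ t in Set.Ioi (0 : ℝ), ENNReal.ofReal (2 * a * Real.exp (-a * t)) = 2 := by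
    rw [← ofReal_integral_eq_lintegral_ofReal
      ((integrableOn_exp_mul_Ioi (neg_lt_zero.2 ha0) 0).const_mul _)
      (Filter.Eventually.of_forall fun t => by positivity), integral_const_mul,
      integral_exp_mul_Ioi (neg_lt_zero.2 ha0)]
    have : 2 * a * (-Real.exp (-a * 0) / -a) = 2 := by
      rw [mul_zero, Real.exp_zero]; field_simp
    rw [this]; simp
  have h6 : ∫⁻ ω, ENNReal.ofReal (Real.exp (a * Z ω ^ 2) - 1) ∂P ≤ 2 := by
    rw [h1, ← h5]
    exact setLIntegral_mono (by fun_prop) h3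
  calc ∫⁻ ω, ENNReal.ofReal (Real.exp (a * Z ω ^ 2)) ∂P
      = ∫⁻ ω, (ENNReal.ofReal (Real.exp (a * Z ω ^ 2) - 1) + 1) ∂P := by
        refine lintegral_congr fun ω => ?_
        rw [← ENNReal.ofReal_one, ← ENNReal.ofReal_add _ zero_le_one, sub_add_cancel]
        have : 0 ≤ a * Z ω ^ 2 := by positivity
        linarith [Real.one_le_exp this]
    _ = ∫⁻ ω, ENNReal.ofReal (Real.exp (a * Z ω ^ 2) - 1) ∂P + 1 := by
        rw [lintegral_add_right _ measurable_const]; simp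
    _ ≤ 2 + 1 := by gcongr
    _ = 3 := by norm_num

theorem HasGaussianTail.integrable_exp_sq {Z : Ω₀ → ℝ} (hZ : Measurable Z) {σ : ℝ} (hσ : 0 < σ)
    (h : HasGaussianTail Z P σ) :
    Integrable (fun ω => Real.exp ((2 * σ ^ 2)⁻¹ * Z ω ^ 2)) P ∧
      ∫ ω, Real.exp ((2 * σ ^ 2)⁻¹ * Z ω ^ 2) ∂P ≤ 3 := by
  have h1 := lintegral_exp_sq_le hZ hσ h
  have hm : Measurable fun ω => Real.exp ((2 * σ ^ 2)⁻¹ * Z ω ^ 2) := by fun_prop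
  constructor
  · exact lintegral_ofReal_ne_top_iff_integrable hm.aestronglyMeasurable
      (Filter.Eventually.of_forall fun ω => (Real.exp_pos _).le) |>.1
      (h1.trans_lt (by norm_num)).ne
  · rw [integral_eq_lintegral_of_nonneg_ae
      (Filter.Eventually.of_forall fun ω => (Real.exp_pos _).le) hm.aestronglyMeasurable]
    exact ENNReal.toReal_le_of_le_ofReal (by norm_num) (by simpa using h1)

theorem exp_mul_abs_mul_le (a x y : ℝ) (ha : 0 ≤ a) :
    Real.exp (a * |x * y|) ≤ (Real.exp (a * x ^ 2) + Real.exp (a * y ^ 2)) / 2 := by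
  have h1 : |x * y| ≤ (x ^ 2 + y ^ 2) / 2 := by
    rw [abs_mul, ← sq_abs x, ← sq_abs y]; nlinarith [sq_nonneg (|x| - |y|)]
  have h2 : Real.exp (a * |x * y|) ≤ Real.exp (a * x ^ 2 / 2 + a * y ^ 2 / 2) :=
    Real.exp_le_exp.2 (by nlinarith)
  refine h2.trans ?_
  have h3 : Real.exp (a * x ^ 2) = Real.exp (a * x ^ 2 / 2) ^ 2 := by
    rw [← Real.exp_nat_mul]; congr 1; push_cast; ring
  have h4 : Real.exp (a * y ^ 2) = Real.exp (a * y ^ 2 / 2) ^ 2 := by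
    rw [← Real.exp_nat_mul]; congr 1; push_cast; ring
  rw [Real.exp_add, h3, h4]
  nlinarith [sq_nonneg (Real.exp (a * x ^ 2 / 2) - Real.exp (a * y ^ 2 / 2))]

theorem HasGaussianTail.integrable_exp_mul {A B : Ω₀ → ℝ} (hA : Measurable A) (hB : Measurable B)
    {σ : ℝ} (hσ : 0 < σ) (h1 : HasGaussianTail A P σ) (h2 : HasGaussianTail B P σ) :
    Integrable (fun ω => Real.exp ((2 * σ ^ 2)⁻¹ * |A ω * B ω|)) P ∧
      ∫ ω, Real.exp ((2 * σ ^ 2)⁻¹ * |A ω * B ω|) ∂P ≤ 3 := by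
  have hA' := h1.integrable_exp_sq hA hσ
  have hB' := h2.integrable_exp_sq hB hσ
  have hle := fun ω => exp_mul_abs_mul_le (2 * σ ^ 2)⁻¹ (A ω) (B ω) (by positivity)
  have hint := (hA'.1.add hB'.1).div_const 2
  have hI : Integrable (fun ω => Real.exp ((2 * σ ^ 2)⁻¹ * |A ω * B ω|)) P := by
    refine hint.mono' (by fun_prop) (Filter.Eventually.of_forall fun ω => ?_)
    rw [Real.norm_eq_abs, Real.abs_exp]
    exact hle ω
  refine ⟨hI, (integral_mono hI hint hle).trans ?_⟩
  simp only [Pi.add_apply]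
  rw [integral_div, integral_add hA'.1 hB'.1]
  linarith [hA'.2, hB'.2]

theorem exp_le_one_add_add_sq_mul (x : ℝ) :
    Real.exp x ≤ 1 + x + x ^ 2 * Real.exp |x| := by
  have h0 : 1 ≤ Real.exp |x| := Real.one_le_exp (abs_nonneg x)
  rcases le_total |x| 1 with h | h
  · have h1 := (le_abs_self _).trans (Real.norm_exp_sub_one_sub_id_le (x := x) h)
    rw [Real.norm_eq_abs, sq_abs] at h1
    nlinarith [sq_nonneg x]
  · rcases le_total 0 x with hx | hx
    · rw [abs_of_nonneg hx] at *
      nlinarith [mul_le_mul_of_nonneg_right (one_le_pow₀ (n := 2) h) (Real.exp_pos x).le]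
    · have h1 : Real.exp x ≤ 1 := Real.exp_le_one_iff.2 hx
      rw [abs_of_nonpos hx] at *
      nlinarith [sq_nonneg x]

/-- One half of the exponent `|y|` dominates `exp |θ y|`, the other dominates `y² / 8`. -/
theorem exp_mul_le_one_add {θ y : ℝ} (hθ : |θ| ≤ 1 / 2) :
    Real.exp (θ * y) ≤ 1 + θ * y + 8 * θ ^ 2 * Real.exp |y| := by
  refine (exp_le_one_add_add_sq_mul (θ * y)).trans ?_
  have h1 : Real.exp |θ * y| ≤ Real.exp (|y| / 2) := by
    rw [abs_mul]; exact Real.exp_le_exp.2 (by nlinarith [abs_nonneg y])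
  have h2 : y ^ 2 ≤ 8 * Real.exp (|y| / 2) := by
    have := Real.quadratic_le_exp_of_nonneg (x := |y| / 2) (by positivity)
    rw [← sq_abs]
    nlinarith [abs_nonneg y]
  have h3 : Real.exp |y| = Real.exp (|y| / 2) * Real.exp (|y| / 2) := by
    rw [← Real.exp_add]; ring_nf
  have h4 : y ^ 2 * Real.exp |θ * y| ≤ 8 * Real.exp |y| := by
    rw [h3, ← mul_assoc]
    exact mul_le_mul h2 h1 (Real.exp_pos _).le (by positivity)
  have h5 := mul_le_mul_of_nonneg_left h4 (sq_nonneg θ)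
  rw [mul_pow]
  linarith

/-- A random variable with an exponential moment has a sub-exponential moment generating
function after centering. -/
theorem mgf_sub_integral_le {W : Ω₀ → ℝ} (hW : Measurable W) {a : ℝ} (ha : 0 < a)
    (hint : Integrable (fun ω => Real.exp (a * |W ω|)) P)
    (hle : ∫ ω, Real.exp (a * |W ω|) ∂P ≤ 3) :
    Integrable W P ∧ a * ∫ ω, |W ω| ∂P ≤ 2 ∧ ∀ t, |t| ≤ a / 2 →
      Integrable (fun ω => Real.exp (t * (W ω - ∫ x, W x ∂P))) P ∧
      mgf (fun ω => W ω - ∫ x, W x ∂P) P t ≤ Real.exp (24 * Real.exp 2 / a ^ 2 * t ^ 2) := by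
  have hWi : Integrable W P := by
    refine (hint.const_mul a⁻¹).mono' hW.aestronglyMeasurable
      (Filter.Eventually.of_forall fun ω => ?_)
    have := Real.add_one_le_exp (a * |W ω|)
    rw [Real.norm_eq_abs, inv_mul_eq_div, le_div_iff₀ ha]
    linarith
  have hbound : a * ∫ ω, |W ω| ∂P ≤ 2 := by
    rw [← integral_const_mul]
    have h1 := integral_mono (hWi.abs.const_mul a) (hint.sub (integrable_const (1 : ℝ)))
      (fun ω => by
        have := Real.add_one_le_exp (a * |W ω|)
        simp only [Pi.sub_apply]; linarith)
    simp only [Pi.sub_apply] at h1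
    rw [integral_sub hint (integrable_const _)] at h1
    simp only [integral_const, probReal_univ, one_smul] at h1
    linarith
  refine ⟨hWi, hbound, fun t ht => ?_⟩
  set m := ∫ x, W x ∂P with hm
  have hma : a * |m| ≤ 2 :=
    (mul_le_mul_of_nonneg_left (abs_integral_le_integral_abs (f := W)) ha.le).trans hbound
  -- Centering costs a factor `exp 2`, as `a * |m| ≤ 2`.
  have hdom : ∀ ω, Real.exp |a * (W ω - m)| ≤ Real.exp 2 * Real.exp (a * |W ω|) := fun ω => by
    rw [← Real.exp_add, abs_mul, abs_of_pos ha]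
    refine Real.exp_le_exp.2 ?_
    have := mul_le_mul_of_nonneg_left (abs_sub (W ω) m) ha.le
    linarith
  have hθ : |t / a| ≤ 1 / 2 := by
    rw [abs_div, abs_of_pos ha, div_le_iff₀ ha]; linarith
  have hpt : ∀ ω, Real.exp (t * (W ω - m)) ≤
      1 + t * (W ω - m) + 8 * (t / a) ^ 2 * (Real.exp 2 * Real.exp (a * |W ω|)) := fun ω => by
    have h1 := exp_mul_le_one_add (θ := t / a) (y := a * (W ω - m)) hθ
    have h2 : t / a * (a * (W ω - m)) = t * (W ω - m) := by field_simp
    rw [h2] at h1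
    have h3 := mul_le_mul_of_nonneg_left (hdom ω) (show 0 ≤ 8 * (t / a) ^ 2 by positivity)
    linarith
  have hcen : Integrable (fun ω => t * (W ω - m)) P := (hWi.sub (integrable_const m)).const_mul t
  have hlin : Integrable (fun ω => 1 + t * (W ω - m)) P := (integrable_const _).add hcen
  have hexp := (hint.const_mul (Real.exp 2)).const_mul (8 * (t / a) ^ 2)
  have hI : Integrable (fun ω => Real.exp (t * (W ω - m))) P := by
    refine (hlin.add hexp).mono' (by fun_prop) (Filter.Eventually.of_forall fun ω => ?_)
    rw [Real.norm_eq_abs, Real.abs_exp]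
    exact hpt ω
  refine ⟨hI, (integral_mono hI (hlin.add hexp) hpt).trans ?_⟩
  simp only [Pi.add_apply]
  rw [integral_add hlin hexp, integral_add (integrable_const _) hcen, integral_const_mul, integral_const_mul,
    integral_const_mul, integral_sub hWi (integrable_const _)]
  simp only [integral_const, probReal_univ, one_smul, ← hm, sub_self, mul_zero, add_zero]
  have h3 := mul_le_mul_of_nonneg_left hle
    (show 0 ≤ 8 * (t / a) ^ 2 * Real.exp 2 by positivity)
  have h4 := Real.add_one_le_exp (24 * Real.exp 2 / a ^ 2 * t ^ 2)
  have h5 : 8 * (t / a) ^ 2 * Real.exp 2 * 3 = 24 * Real.exp 2 / a ^ 2 * t ^ 2 := by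
    field_simp; ring
  linarith

variable {Ω : Type*} [MeasurableSpace Ω] {μ : Measure Ω} [IsProbabilityMeasure μ]

/-- Chernoff bound for sums of independent variables with a common moment generating function
bound. -/
theorem measureReal_le_sum_le {n : ℕ} {Z : Fin n → Ω → ℝ} (hZ : ∀ i, AEMeasurable (Z i) μ)
    (hind : iIndepFun Z μ) {t K : ℝ} (ht : 0 ≤ t)
    (hint : ∀ i, Integrable (fun ω => Real.exp (t * Z i ω)) μ)
    (hmgf : ∀ i, mgf (Z i) μ t ≤ Real.exp (K * t ^ 2)) (s : ℝ) :
    μ.real {ω | s ≤ ∑ i, Z i ω} ≤ Real.exp (-t * s + n * (K * t ^ 2)) := by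
  have h1 : mgf (∑ i, Z i) μ t = ∏ i, mgf (Z i) μ t := hind.mgf_sum₀ hZ Finset.univ
  have hpos : 0 < mgf (∑ i, Z i) μ t := by
    rw [h1]; exact Finset.prod_pos fun i _ => mgf_pos (hint i)
  have h2 : mgf (∑ i, Z i) μ t ≤ Real.exp (n * (K * t ^ 2)) := by
    rw [h1, Real.exp_nat_mul]
    refine (Finset.prod_le_prod (fun i _ => mgf_nonneg) fun i _ => hmgf i).trans_eq ?_
    simp
  have h3 := measure_ge_le_exp_mul_mgf (X := ∑ i, Z i) (μ := μ) s ht (mgf_pos_iff.1 hpos)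
  simp only [Finset.sum_apply] at h3
  refine h3.trans ?_
  rw [Real.exp_add]
  exact mul_le_mul_of_nonneg_left h2 (Real.exp_pos _).le

/-- The rate of the concentration inequality for sample second moments. -/
noncomputable def concentrationRate (a : ℝ) : ℝ := min (a / 2) (a ^ 2 / (48 * Real.exp 2)) / 2

theorem concentrationRate_pos {a : ℝ} (ha : 0 < a) : 0 < concentrationRate a := by
  unfold concentrationRate; positivity

theorem measureReal_abs_mean_sub_le {n : ℕ} {W₀ : Ω₀ → ℝ} (hW₀ : Measurable W₀) {a : ℝ} (ha : 0 < a)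
    (hint : Integrable (fun ω => Real.exp (a * |W₀ ω|)) P)
    (hle : ∫ ω, Real.exp (a * |W₀ ω|) ∂P ≤ 3) {W : Fin n → Ω → ℝ} (hind : iIndepFun W μ)
    (hW : ∀ i, IdentDistrib (W i) W₀ μ P) {η : ℝ} (hη : 0 ≤ η) (hη1 : η ≤ 1) :
    μ.real {ω | η < |(n : ℝ)⁻¹ * ∑ i, W i ω - ∫ x, W₀ x ∂P|} ≤
      2 * Real.exp (-concentrationRate a * n * η ^ 2) := by
  rcases Nat.eq_zero_or_pos n with rfl | hn
  · refine measureReal_le_one.trans ?_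
    simp
  obtain ⟨-, -, hmgf⟩ := mgf_sub_integral_le hW₀ ha hint hle
  set m := ∫ x, W₀ x ∂P with hm
  set K := 24 * Real.exp 2 / a ^ 2 with hK
  -- The Chernoff parameter is `θ * η`. The first entry keeps it in the range of the moment bound,
  -- since `η ≤ 1`; the second lets the quadratic term use at most half of the linear gain.
  set θ := min (a / 2) (a ^ 2 / (48 * Real.exp 2)) with hθ
  have hθ0 : 0 < θ := by positivity
  have hKθ : K * θ ≤ 1 / 2 := by
    have h1 : θ ≤ a ^ 2 / (48 * Real.exp 2) := min_le_right _ _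
    have h2 := mul_le_mul_of_nonneg_left h1 (show 0 ≤ K by positivity)
    refine h2.trans_eq ?_
    rw [hK]; field_simp; norm_num
  have hrate : concentrationRate a = θ / 2 := rfl
  have hθη : θ * η ≤ a / 2 := by
    have := min_le_left (a / 2) (a ^ 2 / (48 * Real.exp 2))
    nlinarith
  have hexponent : -(θ * η) * (n * η) + n * (K * (θ * η) ^ 2) ≤ -concentrationRate a * n * η ^ 2 := by
    rw [hrate]
    have : 0 ≤ θ * n * η ^ 2 := by positivity
    nlinarith
  -- one-sided bound for centered copies and their negatives
  have hident : ∀ i, IdentDistrib (fun ω => W i ω - m) (fun ω => W₀ ω - m) μ P := fun i =>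
    (hW i).comp (measurable_id.sub_const m)
  have hside : ∀ c : ℝ, |c| = 1 →
      μ.real {ω | n * η ≤ ∑ i, c * (W i ω - m)} ≤ Real.exp (-concentrationRate a * n * η ^ 2) := by
    intro c hc
    have htc : |c * (θ * η)| ≤ a / 2 := by
      rw [abs_mul, hc, one_mul, abs_of_nonneg (by positivity)]; exact hθη
    have hcc : c ^ 2 = 1 := by rw [← sq_abs, hc, one_pow]
    have hswap : ∀ x : ℝ, θ * η * (c * x) = c * (θ * η) * x := fun x => by ring
    obtain ⟨hi, hb⟩ := hmgf _ htc
    refine (measureReal_le_sum_le (Z := fun i ω => c * (W i ω - m)) (t := θ * η) (K := K)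
      (fun i => ((hident i).aemeasurable_fst.const_mul c))
      (hind.comp (fun _ x => c * (x - m)) fun _ => by fun_prop) (by positivity) (fun i => ?_)
      (fun i => ?_) (n * η)).trans (Real.exp_le_exp.2 hexponent)
    · simp_rw [hswap]
      have h1 := (hident i).comp (u := fun x => Real.exp (c * (θ * η) * x)) (by fun_prop)
      exact h1.integrable_iff.2 hi
    · have h1 : mgf (fun ω => c * (W i ω - m)) μ (θ * η) =
          mgf (fun ω => W i ω - m) μ (c * (θ * η)) := by
        simp only [mgf, hswap]
      rw [h1, mgf_congr_identDistrib (hident i)]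
      refine hb.trans_eq ?_
      rw [mul_pow, hcc, one_mul]
  have hsub : {ω | η < |(n : ℝ)⁻¹ * ∑ i, W i ω - m|} ⊆
      {ω | n * η ≤ ∑ i, 1 * (W i ω - m)} ∪ {ω | n * η ≤ ∑ i, -1 * (W i ω - m)} := by
    intro ω hω
    simp only [Set.mem_union, Set.mem_ofPred_eq, ← Finset.mul_sum, Finset.sum_sub_distrib,
      Finset.sum_const, Finset.card_univ, Fintype.card_fin, nsmul_eq_mul] at hω ⊢
    have hn0 : (0 : ℝ) < n := Nat.cast_pos.2 hn
    have h1 : ∑ i, W i ω - n * m = n * ((n : ℝ)⁻¹ * ∑ i, W i ω - m) := by field_simp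
    rw [h1]
    rcases lt_abs.1 hω with h | h
    · left; rw [one_mul]; exact mul_le_mul_of_nonneg_left h.le hn0.le
    · right
      have := mul_le_mul_of_nonneg_left h.le hn0.le
      linarith
  refine (measureReal_mono hsub).trans ((measureReal_union_le _ _).trans ?_)
  have e1 := hside 1 (by simp)
  have e2 := hside (-1) (by simp)
  linarith

end Concentration

/-! ### Moments and eigenvalues of the population. -/

section Population

variable {Ω₀ : Type*} [MeasurableSpace Ω₀] {P : Measure Ω₀} {p r : ℕ} {X : Ω₀ → Fin p → ℝ}
  {Y e : Ω₀ → Fin r → ℝ} {α : Fin r → ℝ} {β : Matrix (Fin r) (Fin p) ℝ}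

theorem NIECE.IsLinearModel.measurable_Y (h : IsLinearModel X Y e α β P) : Measurable Y := by
  have hY : Y = fun ω => α + β *ᵥ X ω + e ω := funext h.model
  have hX := h.measurable_X
  have he := h.measurable_e
  rw [hY]
  refine measurable_pi_lambda _ fun i => ?_
  simp only [Pi.add_apply, Matrix.mulVec, dotProduct]
  fun_prop

theorem NIECE.JointSubGaussian.hasGaussianTail_dotProduct {σ : ℝ} (h : JointSubGaussian X Y P σ)
    (w : Fin r → ℝ) (hw : ∑ i, w i ^ 2 = 1) : HasGaussianTail (fun ω => w ⬝ᵥ Y ω) P σ :=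
  fun t ht => by simpa using h 0 w (by simpa using hw) t ht

theorem NIECE.JointSubGaussian.hasGaussianTail_right {σ : ℝ} (h : JointSubGaussian X Y P σ)
    (j : Fin r) : HasGaussianTail (fun ω => Y ω j) P σ := by
  have := h.hasGaussianTail_dotProduct (Pi.single j 1) (by simp [Pi.single_apply])
  simpa using this

theorem NIECE.JointSubGaussian.hasGaussianTail_left {σ : ℝ} (h : JointSubGaussian X Y P σ)
    (j : Fin p) : HasGaussianTail (fun ω => X ω j) P σ := fun t ht => by
  simpa using h (Pi.single j 1) 0 (by simp [Pi.single_apply]) t ht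

theorem covMatrix_apply_of_mean_zero {k l : ℕ} {A : Ω₀ → Fin k → ℝ} {B : Ω₀ → Fin l → ℝ}
    (hA : ∀ i, ∫ ω, A ω i ∂P = 0) (hB : ∀ i, ∫ ω, B ω i ∂P = 0) (i : Fin k) (j : Fin l) :
    covMatrix A B P i j = ∫ ω, A ω i * B ω j ∂P := by
  simp [covMatrix, covariance, hA, hB]

theorem covMatrix_transpose {k l : ℕ} (A : Ω₀ → Fin k → ℝ) (B : Ω₀ → Fin l → ℝ) :
    (covMatrix A B P)ᵀ = covMatrix B A P := by
  ext i j
  exact covariance_comm _ _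

theorem dotProduct_covMatrix_mulVec {Y : Ω₀ → Fin r → ℝ} (hm : ∀ i, ∫ ω, Y ω i ∂P = 0)
    (hint : ∀ i j, Integrable (fun ω => Y ω i * Y ω j) P) (w : Fin r → ℝ) :
    w ⬝ᵥ (covMatrix Y Y P *ᵥ w) = ∫ ω, (w ⬝ᵥ Y ω) * (w ⬝ᵥ Y ω) ∂P := by
  have h1 : ∀ ω, (w ⬝ᵥ Y ω) * (w ⬝ᵥ Y ω) = ∑ i, ∑ j, w i * w j * (Y ω i * Y ω j) := fun ω => by
    rw [dotProduct, Finset.sum_mul_sum]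
    exact Finset.sum_congr rfl fun i _ => Finset.sum_congr rfl fun j _ => by ring
  simp_rw [h1]
  rw [integral_finsetSum _ fun i _ => integrable_finsetSum _ fun j _ => (hint i j).const_mul _]
  simp only [dotProduct, Matrix.mulVec, Finset.mul_sum]
  refine Finset.sum_congr rfl fun i _ => ?_
  rw [integral_finsetSum _ fun j _ => (hint i j).const_mul _]
  refine Finset.sum_congr rfl fun j _ => ?_
  rw [integral_const_mul, covMatrix_apply_of_mean_zero hm hm]
  ring

/-- An eigenvalue is the second moment of `v_jᵀ Y`. The upper bound removes any dependence on `r`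
from the error constant. -/
theorem eigenvalue_bounds [IsProbabilityMeasure P] (h : IsLinearModel X Y e α β P) {σ : ℝ} (hσ : 0 < σ)
    (hsub : JointSubGaussian X Y P σ) {lam : Fin r → ℝ}
    {v : OrthonormalBasis (Fin r) ℝ (EuclideanSpace ℝ (Fin r))}
    (hM : IsOrderedEigenbasis (covMatrix Y Y P) lam v) (j : Fin r) :
    0 ≤ lam j ∧ lam j ≤ 4 * σ ^ 2 := by
  have hY := h.measurable_Y
  have ha : 0 < (2 * σ ^ 2)⁻¹ := by positivity
  have hv : ∑ i, (v j).ofLp i ^ 2 = 1 := by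
    rw [sum_sq_eq_norm_sq, v.orthonormal.1, one_pow]
  have hint : ∀ i j, Integrable (fun ω => Y ω i * Y ω j) P := fun i j => by
    obtain ⟨h1, h2⟩ := (hsub.hasGaussianTail_right i).integrable_exp_mul (by fun_prop) (by fun_prop)
      hσ (hsub.hasGaussianTail_right j)
    exact (mgf_sub_integral_le (by fun_prop) ha h1 h2).1
  have hlam : lam j = ∫ ω, ((v j).ofLp ⬝ᵥ Y ω) * ((v j).ofLp ⬝ᵥ Y ω) ∂P := by
    rw [← dotProduct_covMatrix_mulVec h.mean_Y hint, hM.eigen, dotProduct_smul,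
      ← inner_toLp_eq_dotProduct, real_inner_self_eq_norm_sq, v.orthonormal.1]
    simp
  have hmeas : Measurable fun ω => (v j).ofLp ⬝ᵥ Y ω := by
    simp only [dotProduct]; fun_prop
  obtain ⟨h1, h2⟩ := (hsub.hasGaussianTail_dotProduct _ hv).integrable_exp_mul hmeas hmeas
      hσ (hsub.hasGaussianTail_dotProduct _ hv)
  have h3 := (mgf_sub_integral_le (hmeas.mul hmeas) ha h1 h2).2.1
  simp only [Pi.mul_apply, abs_mul_self] at h3
  rw [← hlam, inv_mul_le_iff₀ (by positivity)] at h3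
  exact ⟨hlam ▸ integral_nonneg fun ω => mul_self_nonneg _, by linarith⟩

end Population

/-! ### Union bound and the main theorem. -/

theorem exists_measurableSet_compl_disjoint {Ω : Type*} [MeasurableSpace Ω] (μ : Measure Ω)
    [IsProbabilityMeasure μ] {ι κ : Type*} [Fintype ι] [Fintype κ] (B : ι → Set Ω) (D : κ → Set Ω)
    {q : ℝ} (hB : ∀ i, μ.real (B i) ≤ q) (hD : ∀ i, μ.real (D i) ≤ q) :
    ∃ A : Set Ω, MeasurableSet A ∧ 1 - (Fintype.card ι * q + Fintype.card κ * q) ≤ μ.real A ∧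
      ∀ ω ∈ A, (∀ i, ω ∉ B i) ∧ ∀ i, ω ∉ D i := by
  set S := (⋃ i, B i) ∪ ⋃ i, D i with hS
  -- The bad sets need not be measurable; the measurable hull has the same measure.
  refine ⟨(toMeasurable μ S)ᶜ, (measurableSet_toMeasurable _ _).compl, ?_, fun ω hω => ?_⟩
  · rw [probReal_compl_eq_one_sub (measurableSet_toMeasurable _ _)]
    have h1 : μ.real (toMeasurable μ S) = μ.real S := by
      rw [measureReal_def, measure_toMeasurable, measureReal_def]
    have h2 : μ.real (⋃ i, B i) ≤ Fintype.card ι * q := by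
      refine (measureReal_iUnion_fintype_le B).trans ?_
      simpa using Finset.sum_le_card_nsmul Finset.univ _ q fun i _ => hB i
    have h3 : μ.real (⋃ i, D i) ≤ Fintype.card κ * q := by
      refine (measureReal_iUnion_fintype_le D).trans ?_
      simpa using Finset.sum_le_card_nsmul Finset.univ _ q fun i _ => hD i
    have h4 := measureReal_union_le (μ := μ) (⋃ i, B i) (⋃ i, D i)
    rw [h1]
    linarith
  · have h1 : ω ∉ S := fun h => hω (subset_toMeasurable μ S h)
    rw [hS, Set.mem_union, Set.mem_iUnion, Set.mem_iUnion] at h1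
    push Not at h1
    exact h1

/-- All entries of the sample covariances are accurate with high probability. -/
theorem exists_measurableSet_abs_sampleCov_sub_le {n p r : ℕ}
    {Ω₀ : Type*} [MeasurableSpace Ω₀] {P : Measure Ω₀} [IsProbabilityMeasure P]
    {X : Ω₀ → Fin p → ℝ} {Y e : Ω₀ → Fin r → ℝ} {α : Fin r → ℝ} {β : Matrix (Fin r) (Fin p) ℝ}
    {Ω : Type*} [MeasurableSpace Ω] {μ : Measure Ω} [IsProbabilityMeasure μ]
    {Xs : Fin n → Ω → Fin p → ℝ} {Ys : Fin n → Ω → Fin r → ℝ}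
    (h : IsLinearModel X Y e α β P) {σ : ℝ} (hσ : 0 < σ) (hsub : JointSubGaussian X Y P σ)
    (hind : iIndepFun (fun i ω => (Xs i ω, Ys i ω)) μ)
    (hid : ∀ i, IdentDistrib (fun ω => (Xs i ω, Ys i ω)) (fun ω => (X ω, Y ω)) μ P)
    {η : ℝ} (hη : 0 ≤ η) (hη1 : η ≤ 1) :
    ∃ A : Set Ω, MeasurableSet A ∧
      1 - (r ^ 2 * (2 * Real.exp (-concentrationRate (2 * σ ^ 2)⁻¹ * n * η ^ 2)) +
        p * r * (2 * Real.exp (-concentrationRate (2 * σ ^ 2)⁻¹ * n * η ^ 2))) ≤ μ.real A ∧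
      ∀ ω ∈ A, (∀ i j, |sampleCov (Matrix.of fun i => Ys i ω) (Matrix.of fun i => Ys i ω) i j -
          covMatrix Y Y P i j| ≤ η) ∧
        ∀ i j, |sampleCov (Matrix.of fun i => Xs i ω) (Matrix.of fun i => Ys i ω) i j -
          covMatrix X Y P i j| ≤ η := by
  have hX := h.measurable_X
  have hY := h.measurable_Y
  have key : ∀ f g : (Fin p → ℝ) × (Fin r → ℝ) → ℝ, Measurable f → Measurable g →
      HasGaussianTail (fun ω => f (X ω, Y ω)) P σ → HasGaussianTail (fun ω => g (X ω, Y ω)) P σ →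
      μ.real {ω | η < |(n : ℝ)⁻¹ * ∑ i, f (Xs i ω, Ys i ω) * g (Xs i ω, Ys i ω) -
        ∫ x, f (X x, Y x) * g (X x, Y x) ∂P|} ≤
      2 * Real.exp (-concentrationRate (2 * σ ^ 2)⁻¹ * n * η ^ 2) := by
    intro f g hf hg htf htg
    have hfm : Measurable fun ω => f (X ω, Y ω) := hf.comp (hX.prodMk hY)
    have hgm : Measurable fun ω => g (X ω, Y ω) := hg.comp (hX.prodMk hY)
    obtain ⟨h1, h2⟩ := htf.integrable_exp_mul hfm hgm hσ htg
    exact measureReal_abs_mean_sub_le (hfm.mul hgm) (by positivity) h1 h2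
      (W := fun i ω => f (Xs i ω, Ys i ω) * g (Xs i ω, Ys i ω))
      (hind.comp (fun _ q => f q * g q) fun _ => hf.mul hg)
      (fun i => (hid i).comp (u := fun q => f q * g q) (hf.mul hg)) hη hη1
  obtain ⟨A, hA, hμA, hAω⟩ := exists_measurableSet_compl_disjoint μ
    (fun q : Fin r × Fin r => {ω | η < |(n : ℝ)⁻¹ * ∑ i, Ys i ω q.1 * Ys i ω q.2 -
      ∫ x, Y x q.1 * Y x q.2 ∂P|})
    (fun q : Fin p × Fin r => {ω | η < |(n : ℝ)⁻¹ * ∑ i, Xs i ω q.1 * Ys i ω q.2 -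
      ∫ x, X x q.1 * Y x q.2 ∂P|})
    (fun q => key (fun z => z.2 q.1) (fun z => z.2 q.2) (by fun_prop) (by fun_prop)
      (hsub.hasGaussianTail_right _) (hsub.hasGaussianTail_right _))
    (fun q => key (fun z => z.1 q.1) (fun z => z.2 q.2) (by fun_prop) (by fun_prop)
      (hsub.hasGaussianTail_left _) (hsub.hasGaussianTail_right _))
  refine ⟨A, hA, ?_, fun ω hω => ⟨fun i j => ?_, fun i j => ?_⟩⟩
  · simpa [sq] using hμA
  · rw [covMatrix_apply_of_mean_zero h.mean_Y h.mean_Y]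
    exact not_lt.1 ((hAω ω hω).1 (i, j))
  · rw [covMatrix_apply_of_mean_zero h.mean_X h.mean_Y]
    exact not_lt.1 ((hAω ω hω).2 (i, j))

theorem theorem5 (d : ℕ) (σ Δ c₀ : ℝ) (hσ : 0 < σ) (hΔ : 0 < Δ) (hc₀ : 0 < c₀) :
    ∃ C c : ℝ, 0 < C ∧ 0 < c ∧
      ∀ (n p r u : ℕ) (hdr : d ≤ r) (ε τ : ℝ)
        -- the population: a mean-zero, jointly sub-Gaussian multivariate linear model
        (Ω₀ : Type*) [MeasurableSpace Ω₀] (P : Measure Ω₀) [IsProbabilityMeasure P]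
        (X : Ω₀ → Fin p → ℝ) (Y e : Ω₀ → Fin r → ℝ)
        (α : Fin r → ℝ) (β : Matrix (Fin r) (Fin p) ℝ)
        -- the sample: `n` observations of `(X, Y)`
        (Ω : Type*) [MeasurableSpace Ω] (μ : Measure Ω) [IsProbabilityMeasure μ]
        (Xs : Fin n → Ω → Fin p → ℝ) (Ys : Fin n → Ω → Fin r → ℝ)
        -- the ordered eigendecomposition of `Σ_Y`
        (lam : Fin r → ℝ) (v : OrthonormalBasis (Fin r) ℝ (EuclideanSpace ℝ (Fin r)))
        -- the matrix `U = Σ_YX Σ_XY`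
        (U : Matrix (Fin r) (Fin r) ℝ),
        IsLinearModel X Y e α β P →
        JointSubGaussian X Y P σ →
        iIndepFun (fun i ω => (Xs i ω, Ys i ω)) μ →
        (∀ i, IdentDistrib (fun ω => (Xs i ω, Ys i ω)) (fun ω => (X ω, Y ω)) μ P) →
        IsOrderedEigenbasis (covMatrix Y Y P) lam v →
        minEigenGap lam d = Δ →
        U = covMatrix Y X P * covMatrix X Y P →
        -- the envelope has dimension `u ≥ 1` and lies in the span of `v_1, …, v_d`
        1 ≤ u →
        Module.finrank ℝ (envelope (covMatrix Y Y P) (covMatrix Y X P)) = u →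
        envelope (covMatrix Y Y P) (covMatrix Y X P) ≤
          Submodule.span ℝ (Set.range (leading hdr v)) →
        0 < ε → ε ≤ 1 / (p : ℝ) →
        maxL1 (leading hdr v) < τ →
        Real.sqrt (8 * c₀ * opNorm U ^ 2 * τ ^ 2 * ε) + (2 * c₀ * opNorm U + 1) * τ ^ 2 * ε
          < scoreGap (fun k => score U (leading hdr v k).ofLp) u →
        ∃ A : Set Ω, MeasurableSet A ∧
          1 - C * (r : ℝ) ^ 2 * Real.exp (-c * n * ε ^ 2)
            - C * p * r * Real.exp (-c * n * ε ^ 2) < μ.real A ∧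
          ∀ ω ∈ A, ∀ Ehat : Submodule ℝ (EuclideanSpace ℝ (Fin r)),
            IsSparseNIECE (Matrix.of fun i => Xs i ω) (Matrix.of fun i => Ys i ω) τ d u Ehat →
            frobNorm (projMatrix Ehat -
              projMatrix (envelope (covMatrix Y Y P) (covMatrix Y X P))) ^ 2 ≤ C * ε * τ ^ 2 := by

  set G := pmdConst (4 * σ ^ 2) Δ d d with hG
  have hG0 : 0 ≤ G := pmdConst_nonneg (by positivity) hΔ d d
  -- Accuracy `δ * ε` instead of `ε` makes the score error fit under the gap for the given `c₀`; the
  -- price is the factor `δ²` in the rate.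
  set δ := min (1 / 4) (c₀ / (4 * (G + 1))) with hδ
  have hδ0 : 0 < δ := by positivity
  have hδ4 : δ ≤ 1 / 4 := min_le_left _ _
  have hGδ : 4 * G * δ ≤ c₀ := by
    have h1 : δ * (4 * (G + 1)) ≤ c₀ := (le_div_iff₀ (by positivity)).1 (min_le_right _ _)
    linarith
  set κ := concentrationRate (2 * σ ^ 2)⁻¹ with hκ
  have hκ0 : 0 < κ := concentrationRate_pos (by positivity)
  -- The first summand is the error constant; `3` exceeds the factor `2` of the two-sided tails,
  -- which makes the probability bound strict.
  refine ⟨2 * d * (G * δ) + 3, κ * δ ^ 2, by positivity, by positivity, ?_⟩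
  intro n p r u hdr ε τ Ω₀ _ P _ X Y e α β Ω _ μ _ Xs Ys lam v U hmodel hsub hind hid hM hgap hU
    hu1 hu hE hε hεp hτ hscore
  have hp : 0 < p := by
    rcases Nat.eq_zero_or_pos p with rfl | hp
    · simp only [Nat.cast_zero, div_zero] at hεp; linarith
    · exact hp
  have hε1 : ε ≤ 1 := hεp.trans (by
    rw [div_le_one (Nat.cast_pos.2 hp)]; exact_mod_cast hp)
  have hr : 0 < r := by
    have := Submodule.finrank_le (envelope (covMatrix Y Y P) (covMatrix Y X P))
    rw [finrank_euclideanSpace_fin, hu] at this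
    omega
  have hη1 : δ * ε ≤ 1 := by nlinarith
  obtain ⟨A, hA, hμA, hAω⟩ := exists_measurableSet_abs_sampleCov_sub_le hmodel hσ hsub hind hid
    (by positivity) hη1
  refine ⟨A, hA, lt_of_lt_of_le ?_ hμA, fun ω hω Ehat hEhat => ?_⟩
  · have h1 : -concentrationRate (2 * σ ^ 2)⁻¹ * n * (δ * ε) ^ 2 = -(κ * δ ^ 2) * n * ε ^ 2 := by
      rw [hκ]; ring
    rw [h1]
    set E := Real.exp (-(κ * δ ^ 2) * n * ε ^ 2)
    have hE0 : 0 < E := Real.exp_pos _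
    have h2 : 0 < (r : ℝ) ^ 2 * E := by positivity
    have h3 : 0 ≤ (p : ℝ) * r * E := by positivity
    have h4 : 0 ≤ 2 * d * (G * δ) := by positivity
    nlinarith [mul_nonneg h4 h2.le, mul_nonneg h4 h3]
  · rw [hU, ← covMatrix_transpose Y X] at hscore
    have hXY := (hAω ω hω).2
    rw [← covMatrix_transpose Y X] at hXY
    have h1 := frobNorm_sparseNIECE_sub_envelope_le hdr hM
      (fun j => (eigenvalue_bounds hmodel hσ hsub hM j).1) (by positivity)
      (fun j => (eigenvalue_bounds hmodel hσ hsub hM j).2) hΔ hgap hu hE hε hεp hτ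
      ((le_add_of_nonneg_left (Real.sqrt_nonneg _)).trans_lt hscore) hδ0.le hδ4 hGδ
      (hAω ω hω).1 hXY hEhat
    refine h1.trans ?_
    have h2 : 0 ≤ ε * τ ^ 2 := by positivity
    rw [← hG]
    linarith
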